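/- **Setting.** Let $d\in\mathbb{N}$ and let $\mathcal{T}$ be a countable family of invertible affine transformations $T(y)=A_Ty+c_T$ of $\mathbb{R}^d$. For $U\subset\mathbb{R}^d$ write $U_T:=T(U)$. A family $\{U_T\}_{T\in\mathcal{T}}$ is an *admissible covering* of $\mathbb{R}^d$ if $\bigcup_T U_T=\mathbb{R}^d$ and there is $n_0\in\mathbb{N}$ such that for every $T$ at most $n_0$ indices $T'$ satisfy $U_{T'}\cap U_T\neq\emptyset$. Let $P\subset Q\subset\mathbb{R}^d$ be bounded open sets, with $P$ non-empty and $\overline{P}\subset Q$ compact, such that $\mathcal{Q}=\{Q_T\}_{T\in\mathcal{T}}$ is a *structured covering*, that is: - $\{P_T\}_{T\in\mathcal{T}}$ and $\{Q_T\}_{T\in\mathcal{T}}$ are admissible coverings of $\mathbb{R}^d$; - there are points $x_T\in Q_T$ and $\delta>0$ with $\|x_T-x_{T'}\|_2\ge\delta$ for $T\ne T'$, and there is $C>0$ with $1+\|y\|_2\le C(1+\|z\|_2)$ for all $y,z\in Q_T$ and all $T\in\mathcal{T}$. Fix such points and put $\omega_T:=1+\|x_T\|_2$. Let $\{\psi_T\}_{T\in\mathcal{T}}\subset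 C_c^\infty(\mathbb{R}^d)$ be non-negative functions with $\operatorname{supp}\psi_T\subset Q_T$ and $\sum_T\psi_T(y)=1$ for all $y\in\mathbb{R}^d$. For $s\in\mathbb{R}$ and $1\le p,q\le\infty$ let $D(\mathcal{Q},L^p,\ell^q_{\omega^s})$ be the space of all $f\in\mathcal{S}'(\mathbb{R}^d)$ with $$\|f\|_{D(\mathcal{Q},L^p,\ell^q_{\omega^s})}:=\Big\|\big\{\omega_T^s\,\|\psi_Tf\|_{L^p}\big\}_{T\in\mathcal{T}}\Big\|_{\ell^q}<\infty,$$ where $\|u\|_{L^p}=\infty$ if the distribution $u$ is not given by an $L^p$ function. **Theorem.** Let $s\in\mathbb{R}$ and $1\le p,q\le\infty$. 1. $\mathcal{S}(\mathbb{R}^d)\hookrightarrow D(\mathcal{Q},L^p,\ell^q_{\omega^s})\hookrightarrow\mathcal{S}'(\mathbb{R}^d)$, both inclusions being continuous; moreover there are $C$ and $N$ such that $$|\langle f,\varphi\rangle|\le C\,\|f\|_{D(\mathcal{Q},L^p,\ell^q_{\omega^s})}\max_{k,n\le N}\ \sup_{y}\|y\|_2^k\,\|D^n\varphi(y)\|$$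 for all $f\in D(\mathcal{Q},L^p,\ell^q_{\omega^s})$ and $\varphi\in\mathcal{S}(\mathbb{R}^d)$. 2. $D(\mathcal{Q},L^p,\ell^q_{\omega^s})$ is a Banach space. 3. If $p,q<\infty$, then $\mathcal{S}(\mathbb{R}^d)$ is dense in $D(\mathcal{Q},L^p,\ell^q_{\omega^s})$. 4. If $p,q<\infty$ and $1/p+1/p'=1$, $1/q+1/q'=1$, then the dual space of $D(\mathcal{Q},L^p,\ell^q_{\omega^s})$ can be identified with $D(\mathcal{Q},L^{p'},\ell^{q'}_{\omega^{-s}})$: there is a linear bijection $\sigma\mapsto\Phi_\sigma$ of $D(\mathcal{Q},L^{p'},\ell^{q'}_{\omega^{-s}})$ onto the dual space, continuous in both directions for the norms (equivalence of norms), with $\Phi_\sigma(\varphi)=\langle\sigma,\varphi\rangle$ for all $\varphi\in\mathcal{S}(\mathbb{R}^d)$. -/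

import Mathlib

open MeasureTheory Set Function
open scoped ENNReal SchwartzMap ContDiff

noncomputable section

namespace TimeDecomposition

/-- `ℝ^d` with the Euclidean norm. -/
abbrev Euc (d : ℕ) : Type := EuclideanSpace ℝ (Fin d)

/-! ### Structured coverings -/

section Coverings

variable {d : ℕ} {ι : Type*}

/-- An admissible covering of `ℝ^d`: the sets cover `ℝ^d`, and there is `n₀` such that every
member of the covering meets at most `n₀` members. -/
structure IsAdmissibleCovering (U : ι → Set (Euc d)) : Prop where
  iUnion_eq : ⋃ i, U i = univ
  neighbours : ∃ n₀ : ℕ, ∀ i, {j | (U j ∩ U i).Nonempty}.encard ≤ n₀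

/-- A function `u : ℝ^d → (0,∞)` is moderate with respect to the covering `U`. -/
structure IsModerate (U : ι → Set (Euc d)) (u : Euc d → ℝ) : Prop where
  pos : ∀ y, 0 < u y
  bound : ∃ C : ℝ, 0 < C ∧ ∀ i, ∀ y ∈ U i, ∀ z ∈ U i, u y ≤ C * u z

/-- A `δ`-separated family of points, for some `δ > 0`. -/
def IsSeparatedFamily (x : ι → Euc d) : Prop :=
  ∃ δ : ℝ, 0 < δ ∧ ∀ i j, i ≠ j → δ ≤ ‖x i - x j‖

/-- The images `T(Q)` of a set under a family of invertible affine maps. -/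
def affineFamily (T : ι → (Euc d ≃ᵃ[ℝ] Euc d)) (Q : Set (Euc d)) (i : ι) : Set (Euc d) :=
  T i '' Q

/-- The family `(T(Q))_T` is a structured covering of `ℝ^d`, with inner set `P` and with
the separated points `x_T ∈ T(Q)` from which the weight `1 + ‖x_T‖` is derived. -/
structure IsStructuredCovering (T : ι → (Euc d ≃ᵃ[ℝ] Euc d)) (P Q : Set (Euc d))
    (x : ι → Euc d) : Prop where
  isOpen_P : IsOpen P
  isOpen_Q : IsOpen Q
  bounded_Q : Bornology.IsBounded Q
  nonempty_P : P.Nonempty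
  closure_P_subset : closure P ⊆ Q
  isCompact_closure_P : IsCompact (closure P)
  admissible_P : IsAdmissibleCovering (affineFamily T P)
  admissible_Q : IsAdmissibleCovering (affineFamily T Q)
  separated : IsSeparatedFamily x
  mem : ∀ i, x i ∈ affineFamily T Q i
  moderate : IsModerate (affineFamily T Q) (fun y => 1 + ‖y‖)

/-- A (smooth, compactly supported, non-negative) partition of unity subordinate to the
covering `U`. -/
structure IsBAPU (U : ι → Set (Euc d)) (ψ : ι → Euc d → ℝ) : Prop where
  contDiff : ∀ i, ContDiff ℝ ∞ (ψ i)
  hasCompactSupport : ∀ i, HasCompactSupport (ψ i)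
  nonneg : ∀ i y, 0 ≤ ψ i y
  tsupport_subset : ∀ i, tsupport (ψ i) ⊆ U i
  sum_eq_one : ∀ y, HasSum (fun i => ψ i y) 1

/-- The weight `ω_T = 1 + ‖x_T‖`. -/
def weight (x : ι → Euc d) (i : ι) : ℝ := 1 + ‖x i‖

end Coverings

/-! ### The norm -/

section LqNorm

variable {ι : Type*}

/-- The `ℓ^q` norm of a family of extended non-negative numbers. -/
def lqNorm (q : ℝ≥0∞) (a : ι → ℝ≥0∞) : ℝ≥0∞ :=
  if q = ⊤ then ⨆ i, a i else (∑' i, a i ^ q.toReal) ^ (1 / q.toReal)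

theorem lqNorm_eq_eLpNorm {q : ℝ≥0∞} (hq : 1 ≤ q) (a : ι → ℝ≥0∞) :
    lqNorm q a = @eLpNorm ι ℝ≥0∞ _ ⊤ a q (@Measure.count ι ⊤) := by
  let _ : MeasurableSpace ι := ⊤
  have hq0 : q ≠ 0 := (zero_lt_one.trans_le hq).ne'
  unfold lqNorm
  split_ifs with h
  · subst h
    rw [eLpNorm_exponent_top, eLpNormEssSup_eq_essSup_enorm, essSup_count]
    simp
  · rw [eLpNorm_eq_lintegral_rpow_enorm_toReal hq0 h, lintegral_count]
    simp

theorem lqNorm_mono (q : ℝ≥0∞) {a b : ι → ℝ≥0∞} (h : ∀ i, a i ≤ b i) :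
    lqNorm q a ≤ lqNorm q b := by
  unfold lqNorm
  split_ifs
  · exact iSup_mono h
  · gcongr with i
    exact h i

theorem lqNorm_add_le {q : ℝ≥0∞} (hq : 1 ≤ q) (a b : ι → ℝ≥0∞) :
    lqNorm q (fun i => a i + b i) ≤ lqNorm q a + lqNorm q b := by
  let _ : MeasurableSpace ι := ⊤
  have key : ∀ c : ι → ℝ≥0∞, AEStronglyMeasurable c Measure.count := fun c =>
    (Measurable.stronglyMeasurable (measurable_from_top)).aestronglyMeasurable
  rw [lqNorm_eq_eLpNorm hq, lqNorm_eq_eLpNorm hq, lqNorm_eq_eLpNorm hq]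
  exact eLpNorm_add_le (key a) (key b) hq

theorem lqNorm_const_mul {q : ℝ≥0∞} (hq : 1 ≤ q) (c : ℝ≥0∞) (a : ι → ℝ≥0∞) :
    lqNorm q (fun i => c * a i) = c * lqNorm q a := by
  unfold lqNorm
  split_ifs with h
  · rw [ENNReal.mul_iSup]
  · have h0 : 0 < q.toReal := ENNReal.toReal_pos (zero_lt_one.trans_le hq).ne' h
    simp_rw [ENNReal.mul_rpow_of_nonneg _ _ h0.le]
    rw [ENNReal.tsum_mul_left, ENNReal.mul_rpow_of_nonneg _ _ (by positivity),
      ← ENNReal.rpow_mul, mul_one_div_cancel h0.ne', ENNReal.rpow_one]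

theorem lqNorm_zero {q : ℝ≥0∞} (hq : 1 ≤ q) : lqNorm q (fun _ : ι => 0) = 0 := by
  simpa using lqNorm_const_mul hq 0 (fun _ : ι => 0)

end LqNorm

section Norm

variable {d : ℕ} {ι : Type*}

/-- The `L^p` norm of a tempered distribution: the norm of the (unique) `L^p` function that
represents it, and `∞` if there is none. -/
def distLpNorm (p : ℝ≥0∞) [Fact (1 ≤ p)] (u : 𝓢'(Euc d, ℂ)) : ℝ≥0∞ :=
  ⨅ (g : Lp ℂ p (volume : Measure (Euc d))) (_ : Lp.toTemperedDistribution g = u), ‖g‖ₑ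

variable (p q : ℝ≥0∞) [Fact (1 ≤ p)] [Fact (1 ≤ q)]

theorem distLpNorm_le {u : 𝓢'(Euc d, ℂ)} (g : Lp ℂ p (volume : Measure (Euc d)))
    (h : Lp.toTemperedDistribution g = u) : distLpNorm p u ≤ ‖g‖ₑ :=
  iInf₂_le g h

theorem distLpNorm_zero : distLpNorm p (0 : 𝓢'(Euc d, ℂ)) = 0 := by
  refine le_antisymm ((distLpNorm_le p 0 ?_).trans (by simp)) zero_le
  exact map_zero (Lp.toTemperedDistributionCLM ℂ (volume : Measure (Euc d)) p)

theorem distLpNorm_add_le (u v : 𝓢'(Euc d, ℂ)) :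
    distLpNorm p (u + v) ≤ distLpNorm p u + distLpNorm p v := by
  have h : ∀ g h : Lp ℂ p (volume : Measure (Euc d)),
      Lp.toTemperedDistribution g = u → Lp.toTemperedDistribution h = v →
      distLpNorm p (u + v) ≤ ‖g‖ₑ + ‖h‖ₑ := fun g h hg hh => by
    refine (distLpNorm_le p (g + h) ?_).trans (enorm_add_le g h)
    rw [← hg, ← hh]
    exact map_add (Lp.toTemperedDistributionCLM ℂ (volume : Measure (Euc d)) p) g h
  conv_rhs => unfold distLpNorm
  simp only [iInf_subtype']
  exact ENNReal.le_iInf_add_iInf fun g h' => h g h' g.2 h'.2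

theorem distLpNorm_smul_le (c : ℂ) (u : 𝓢'(Euc d, ℂ)) :
    distLpNorm p (c • u) ≤ ‖c‖ₑ * distLpNorm p u := by
  rcases eq_or_ne c 0 with rfl | hc
  · rw [show (0 : ℂ) • u = 0 from zero_smul ℂ u, distLpNorm_zero]
    simp
  · conv_rhs => unfold distLpNorm
    simp only [iInf_subtype']
    rw [ENNReal.mul_iInf_of_ne (by simpa using hc) (by simp)]
    refine le_iInf fun g => ?_
    refine (distLpNorm_le p (c • g.1) ?_).trans (enorm_smul_le)
    exact (map_smul (Lp.toTemperedDistributionCLM ℂ (volume : Measure (Euc d)) p) c g.1).trans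
      (congrArg (fun v => c • v) g.2)

/-- Multiplication of a tempered distribution by a smooth compactly supported real function. -/
def cutoff (χ : Euc d → ℝ) : 𝓢'(Euc d, ℂ) →L[ℂ] 𝓢'(Euc d, ℂ) :=
  TemperedDistribution.smulLeftCLM ℂ (fun y => (χ y : ℂ))

/-- The extended norm `‖ (ω_T^s ‖ψ_T f‖_{L^p})_T ‖_{ℓ^q}` with `ω_T = 1 + ‖x_T‖`. -/
def decompNorm (x : ι → Euc d) (ψ : ι → Euc d → ℝ) (s : ℝ) (f : 𝓢'(Euc d, ℂ)) : ℝ≥0∞ :=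
  lqNorm q (fun i => ENNReal.ofReal (weight x i ^ s) * distLpNorm p (cutoff (ψ i) f))

theorem decompNorm_zero (x : ι → Euc d) (ψ : ι → Euc d → ℝ) (s : ℝ) :
    decompNorm p q x ψ s 0 = 0 := by
  simp [decompNorm, distLpNorm_zero, lqNorm_zero (Fact.out : 1 ≤ q)]

theorem decompNorm_add_le (x : ι → Euc d) (ψ : ι → Euc d → ℝ) (s : ℝ) (f g : 𝓢'(Euc d, ℂ)) :
    decompNorm p q x ψ s (f + g) ≤ decompNorm p q x ψ s f + decompNorm p q x ψ s g := by
  refine le_trans (lqNorm_mono q fun i => ?_) (lqNorm_add_le (Fact.out : 1 ≤ q) _ _)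
  rw [map_add, ← mul_add]
  gcongr
  exact distLpNorm_add_le p _ _

theorem decompNorm_smul_le (x : ι → Euc d) (ψ : ι → Euc d → ℝ) (s : ℝ) (c : ℂ)
    (f : 𝓢'(Euc d, ℂ)) :
    decompNorm p q x ψ s (c • f) ≤ ‖c‖ₑ * decompNorm p q x ψ s f := by
  unfold decompNorm
  rw [← lqNorm_const_mul (Fact.out : 1 ≤ q)]
  refine lqNorm_mono q fun i => ?_
  rw [map_smul, mul_left_comm]
  gcongr
  exact distLpNorm_smul_le p c _

/-- The tempered distributions of finite decomposition norm, as a linear subspace of `𝓢'`. -/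
def decompSubmodule (x : ι → Euc d) (ψ : ι → Euc d → ℝ) (s : ℝ) :
    Submodule ℂ 𝓢'(Euc d, ℂ) where
  carrier := {f | decompNorm p q x ψ s f < ⊤}
  zero_mem' := by
    change decompNorm p q x ψ s 0 < ⊤
    simp [decompNorm_zero]
  add_mem' hf hg := (decompNorm_add_le p q x ψ s _ _).trans_lt (ENNReal.add_lt_top.2 ⟨hf, hg⟩)
  smul_mem' c _ hf :=
    (decompNorm_smul_le p q x ψ s c _).trans_lt (ENNReal.mul_lt_top enorm_lt_top hf)

end Norm

/-! ### The decomposition space -/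

section Space

variable {d : ℕ} {ι : Type*}

/-- The decomposition space `D(Q, L^p, ℓ^q_{ω^s})` with `ω_T = 1 + ‖x_T‖`: the tempered
distributions `f` with `‖ (ω_T^s ‖ψ_T f‖_{L^p})_T ‖_{ℓ^q} < ∞`. It carries the topology of this
norm, not the one it would inherit as a subspace of `𝓢'`. -/
def DecompSpace (x : ι → Euc d) (ψ : ι → Euc d → ℝ) (s : ℝ) (p q : ℝ≥0∞)
    [Fact (1 ≤ p)] [Fact (1 ≤ q)] : Type :=
  decompSubmodule p q x ψ s

namespace DecompSpace

variable (x : ι → Euc d) (ψ : ι → Euc d → ℝ) (s : ℝ) (p q : ℝ≥0∞) [Fact (1 ≤ p)] [Fact (1 ≤ q)]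

instance : AddCommGroup (DecompSpace x ψ s p q) :=
  inferInstanceAs (AddCommGroup (decompSubmodule p q x ψ s))

instance : Module ℂ (DecompSpace x ψ s p q) :=
  inferInstanceAs (Module ℂ (decompSubmodule p q x ψ s))

/-- The inclusion of the decomposition space in the tempered distributions. -/
def toDistribution : DecompSpace x ψ s p q →ₗ[ℂ] 𝓢'(Euc d, ℂ) :=
  (decompSubmodule p q x ψ s).subtype

/-- The norm `‖ (ω_T^s ‖ψ_T f‖_{L^p})_T ‖_{ℓ^q}`. -/
instance : Norm (DecompSpace x ψ s p q) :=
  ⟨fun f => (decompNorm p q x ψ s (toDistribution x ψ s p q f)).toReal⟩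

theorem norm_def (f : DecompSpace x ψ s p q) :
    ‖f‖ = (decompNorm p q x ψ s (toDistribution x ψ s p q f)).toReal := rfl

theorem decompNorm_lt_top (f : DecompSpace x ψ s p q) :
    decompNorm p q x ψ s (toDistribution x ψ s p q f) < ⊤ := f.2

theorem norm_smul_le_aux (c : ℂ) (f : DecompSpace x ψ s p q) : ‖c • f‖ ≤ ‖c‖ * ‖f‖ := by
  rw [norm_def, norm_def, map_smul, ← toReal_enorm c, ← ENNReal.toReal_mul]
  exact ENNReal.toReal_mono
    (ENNReal.mul_lt_top enorm_lt_top (decompNorm_lt_top x ψ s p q f)).ne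
    (decompNorm_smul_le p q x ψ s c _)

/-- The norm makes the decomposition space a seminormed space; that it is a norm is not part
of this instance. -/
instance : SeminormedAddCommGroup (DecompSpace x ψ s p q) :=
  SeminormedAddCommGroup.ofCore (𝕜 := ℂ)
    { norm_nonneg := fun _ => ENNReal.toReal_nonneg
      norm_smul := fun c f => by
        refine le_antisymm (norm_smul_le_aux x ψ s p q c f) ?_
        rcases eq_or_ne c 0 with rfl | hc
        · rw [norm_zero, zero_mul]
          exact ENNReal.toReal_nonneg
        · have h := norm_smul_le_aux x ψ s p q c⁻¹ (c • f)
          rw [inv_smul_smul₀ hc, norm_inv] at h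
          rwa [le_inv_mul_iff₀ (norm_pos_iff.2 hc)] at h
      norm_triangle := fun f g => by
        rw [norm_def, norm_def, norm_def, map_add,
          ← ENNReal.toReal_add (decompNorm_lt_top x ψ s p q f).ne
            (decompNorm_lt_top x ψ s p q g).ne]
        exact ENNReal.toReal_mono
          (ENNReal.add_lt_top.2
            ⟨decompNorm_lt_top x ψ s p q f, decompNorm_lt_top x ψ s p q g⟩).ne
          (decompNorm_add_le p q x ψ s _ _) }

instance : NormedSpace ℂ (DecompSpace x ψ s p q) where
  norm_smul_le := norm_smul_le_aux x ψ s p q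

end DecompSpace

end Space

end TimeDecomposition

end

/-!
An element of the decomposition space is a function: if every `ψ_i f` is represented by an `L^p`
function `g_i`, then `ψ_j g_i = ψ_i g_j`, and a locally finite sum glues the `g_i` to one function
`F` with `ψ_i F = g_i` (`exists_glue`, `exists_isDensity`). Everything is then proved for such
densities `F` (`IsDensity`) and their norm `funNorm`.

*Hölder's inequality.* Because the members of the covering have boundedly many neighbours and the
weights of neighbours are comparable, `∫ |F H|` is bounded by the product of the norms of `F` and
`H` in the spaces of conjugate exponents and opposite weights (`exists_lintegral_mul_le`). A
Schwartz function lies in every one of the spaces: the separation of the points `x_i` makes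
`∑ ω_i^{-(d+1)}` finite, and the measure of the member `U_i` grows at most like `ω_i^d`
(`exists_funNorm_schwartz_le`). Together these give both embeddings. That `f` acts on all Schwartz
functions as integration against `F`, and not only on those of compact support, follows since the
latter are dense (`schwartz_functional_ext`, `IsDensity.apply_eq_integral`).

*Completeness.* For a Cauchy sequence the localisations converge in `L^p` for each `i`, the limits
glue, and the norm is lower semicontinuous (`DecompSpace.completeSpace`).

*Duality.* A functional `Λ` composed with the synthesis maps `v ↦ ψ_i v` is a functional on
`L^p(U_i)`. Since `U_i` has finite measure, the Radon–Nikodym theorem represents it by a function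
`g_i` in `L^{p'}` (`exists_memLp_eq_integral_mul`). The `g_i` are compatible and glue to `H`; the
`ℓ^{q'}` bound for the weighted norms of the `g_i` is the converse of Hölder's inequality for
sequences, tested on `∑ b_i ω_i^{-s} ψ_i v_i` with `v_i` almost norming for `g_i`
(`DecompSpace.exists_representative`). For `q < ∞` the sum of the localisations of `f` converges to
`f` in norm (`DecompSpace.hasSum_localisations`), so that `Λ` is integration against `H`.

*Density.* A functional that vanishes on the Schwartz functions is the pairing with an element that
is zero as a distribution, hence is zero; the Hahn–Banach theorem gives the density
(`DecompSpace.dense_schwartz`).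
-/

namespace TimeDecomposition

open Filter Topology

/-! ### The sequence norms `ℓ^q` -/

section Sequences

variable {ι : Type*}

theorem lqNorm_top (a : ι → ℝ≥0∞) : lqNorm ⊤ a = ⨆ i, a i := if_pos rfl

theorem lqNorm_of_ne_top {q : ℝ≥0∞} (hq : q ≠ ⊤) (a : ι → ℝ≥0∞) :
    lqNorm q a = (∑' i, a i ^ q.toReal) ^ (1 / q.toReal) := if_neg hq

theorem toReal_pos_of_one_le {q : ℝ≥0∞} (hq : 1 ≤ q) (hq' : q ≠ ⊤) : 0 < q.toReal :=
  ENNReal.toReal_pos (zero_lt_one.trans_le hq).ne' hq'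

theorem one_le_toReal {q : ℝ≥0∞} (hq : 1 ≤ q) (hq' : q ≠ ⊤) : 1 ≤ q.toReal := by
  simpa using (ENNReal.toReal_le_toReal ENNReal.one_ne_top hq').2 hq

theorem holderConjugate_toReal {q q' : ℝ≥0∞} (h : q.HolderConjugate q') (hq : q ≠ ⊤)
    (hq' : q' ≠ ⊤) : q.toReal.HolderConjugate q'.toReal := by
  have := ENNReal.HolderTriple.toReal 1 (toReal_pos_of_one_le h.one_le hq)
    (toReal_pos_of_one_le h.symm.one_le hq')
  rwa [ENNReal.toReal_one] at this

theorem lqNorm_le_iff_of_ne_top {q : ℝ≥0∞} (hq : 1 ≤ q) (hq' : q ≠ ⊤) {a : ι → ℝ≥0∞}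
    {K : ℝ≥0∞} : lqNorm q a ≤ K ↔ ∑' i, a i ^ q.toReal ≤ K ^ q.toReal := by
  rw [lqNorm_of_ne_top hq', one_div, ENNReal.rpow_inv_le_iff (toReal_pos_of_one_le hq hq')]

theorem le_lqNorm {q : ℝ≥0∞} (hq : 1 ≤ q) (a : ι → ℝ≥0∞) (i : ι) : a i ≤ lqNorm q a := by
  by_cases h : q = ⊤
  · subst h
    rw [lqNorm_top]
    exact le_iSup a i
  · rw [lqNorm_of_ne_top h, one_div, ENNReal.le_rpow_inv_iff (toReal_pos_of_one_le hq h)]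
    exact ENNReal.le_tsum i

theorem lqNorm_le_tsum {q : ℝ≥0∞} (hq : 1 ≤ q) (a : ι → ℝ≥0∞) : lqNorm q a ≤ ∑' i, a i := by
  by_cases h : q = ⊤
  · subst h
    rw [lqNorm_top]
    exact iSup_le fun i => ENNReal.le_tsum i
  · rw [lqNorm_le_iff_of_ne_top hq h, ENNReal.tsum_eq_iSup_sum]
    refine iSup_le fun I => ?_
    have h1 : ∀ (I : Finset ι), ∑ i ∈ I, a i ^ q.toReal ≤ (∑ i ∈ I, a i) ^ q.toReal := by
      classical
      intro I
      induction I using Finset.induction_on with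
      | empty => simp
      | insert j I hj ih =>
        rw [Finset.sum_insert hj, Finset.sum_insert hj]
        exact (add_le_add_right ih _).trans (ENNReal.add_rpow_le_rpow_add _ _ (one_le_toReal hq h))
    exact (h1 I).trans (ENNReal.rpow_le_rpow (ENNReal.sum_le_tsum I) ENNReal.toReal_nonneg)

/-- Summing a sequence over boundedly many neighbours is bounded on `ℓ^q`. -/
theorem lqNorm_sum_neighbours_le {q : ℝ≥0∞} (hq : 1 ≤ q) {N : ι → Finset ι} {n₀ : ℕ}
    (hN : ∀ i, (N i).card ≤ n₀) (hsymm : ∀ i j, j ∈ N i ↔ i ∈ N j) (a : ι → ℝ≥0∞) :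
    lqNorm q (fun k => ∑ i ∈ N k, a i) ≤ n₀ * lqNorm q a := by
  classical
  by_cases h : q = ⊤
  · subst h
    rw [lqNorm_top]
    refine iSup_le fun k => ?_
    calc ∑ i ∈ N k, a i ≤ ∑ _i ∈ N k, lqNorm ⊤ a := Finset.sum_le_sum fun i _ => le_lqNorm hq a i
      _ = (N k).card * lqNorm ⊤ a := by simp
      _ ≤ n₀ * lqNorm ⊤ a := by gcongr; exact hN k
  · have h1 := one_le_toReal hq h
    rw [lqNorm_le_iff_of_ne_top hq h, ENNReal.mul_rpow_of_nonneg _ _ ENNReal.toReal_nonneg]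
    set r := q.toReal with hr
    have hsum : (lqNorm q a) ^ r = ∑' i, a i ^ r := by
      rw [lqNorm_of_ne_top h, ← ENNReal.rpow_mul, one_div_mul_cancel (by positivity),
        ENNReal.rpow_one]
    rw [hsum]
    calc ∑' k, (∑ i ∈ N k, a i) ^ r
        ≤ ∑' k, (n₀ : ℝ≥0∞) ^ (r - 1) * ∑ i ∈ N k, a i ^ r := by
          refine ENNReal.tsum_le_tsum fun k => ?_
          refine (ENNReal.rpow_sum_le_const_mul_sum_rpow (N k) a h1).trans ?_
          gcongr
          exact hN k
      _ = (n₀ : ℝ≥0∞) ^ (r - 1) * ∑' k, ∑' i, if i ∈ N k then a i ^ r else 0 := by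
          rw [ENNReal.tsum_mul_left]
          congr 2
          ext k
          rw [tsum_eq_sum (s := N k) fun i hi => if_neg hi]
          exact Finset.sum_congr rfl fun i hi => (if_pos hi).symm
      _ = (n₀ : ℝ≥0∞) ^ (r - 1) * ∑' i, ∑ k ∈ N i, a i ^ r := by
          rw [ENNReal.tsum_comm]
          congr 2
          ext i
          rw [tsum_eq_sum (s := N i) fun k hk => if_neg fun hi => hk ((hsymm i k).2 hi)]
          exact Finset.sum_congr rfl fun k hk => if_pos ((hsymm i k).1 hk)
      _ ≤ (n₀ : ℝ≥0∞) ^ (r - 1) * ∑' i, (n₀ : ℝ≥0∞) * a i ^ r := by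
          gcongr with i
          rw [Finset.sum_const, nsmul_eq_mul]
          gcongr
          exact hN i
      _ = (n₀ : ℝ≥0∞) ^ r * ∑' i, a i ^ r := by
          rw [ENNReal.tsum_mul_left, ← mul_assoc]
          congr 1
          nth_rewrite 2 [← ENNReal.rpow_one (n₀ : ℝ≥0∞)]
          rw [← ENNReal.rpow_add_of_nonneg _ _ (by linarith) zero_le_one]
          ring_nf

/-- Hölder's inequality for sequences. -/
theorem tsum_mul_le_lqNorm_mul_lqNorm {q q' : ℝ≥0∞} (h : q.HolderConjugate q')
    (a b : ι → ℝ≥0∞) : ∑' i, a i * b i ≤ lqNorm q a * lqNorm q' b := by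
  have hq := h.one_le
  have hq' := h.symm.one_le
  by_cases h1 : q = ⊤
  · obtain rfl : q' = 1 := (ENNReal.HolderConjugate.eq_top_iff_eq_one q q').1 h1
    subst h1
    rw [lqNorm_of_ne_top ENNReal.one_ne_top]
    simp only [ENNReal.toReal_one, ENNReal.rpow_one, div_one]
    rw [← ENNReal.tsum_mul_left]
    gcongr with i
    exact le_lqNorm hq a i
  by_cases h2 : q' = ⊤
  · obtain rfl : q = 1 := (ENNReal.HolderConjugate.eq_top_iff_eq_one q' q).1 h2
    subst h2
    rw [lqNorm_of_ne_top ENNReal.one_ne_top]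
    simp only [ENNReal.toReal_one, ENNReal.rpow_one, div_one]
    rw [← ENNReal.tsum_mul_right]
    gcongr with i
    exact le_lqNorm hq' b i
  have hpq := holderConjugate_toReal h h1 h2
  rw [ENNReal.tsum_eq_iSup_sum]
  refine iSup_le fun I => (ENNReal.inner_le_Lp_mul_Lq I a b hpq).trans ?_
  rw [lqNorm_of_ne_top h1, lqNorm_of_ne_top h2]
  gcongr <;> exact ENNReal.sum_le_tsum I

/-- The `ℓ^q` norm is lower semicontinuous for pointwise convergence. -/
theorem lqNorm_le_of_tendsto {q : ℝ≥0∞} (hq : 1 ≤ q) {u : ℕ → ι → ℝ≥0∞} {a : ι → ℝ≥0∞}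
    {K : ℝ≥0∞} (hu : ∀ i, Tendsto (fun n => u n i) atTop (𝓝 (a i)))
    (hK : ∀ᶠ n in atTop, lqNorm q (u n) ≤ K) : lqNorm q a ≤ K := by
  by_cases h : q = ⊤
  · subst h
    rw [lqNorm_top]
    refine iSup_le fun i => le_of_tendsto (hu i) ?_
    filter_upwards [hK] with n hn using (le_lqNorm hq (u n) i).trans hn
  · rw [lqNorm_le_iff_of_ne_top hq h, ENNReal.tsum_eq_iSup_sum]
    refine iSup_le fun I => ?_
    refine le_of_tendsto (tendsto_finsetSum I fun i _ => ((ENNReal.continuous_rpow_const).tendsto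
      (a i)).comp (hu i)) ?_
    filter_upwards [hK] with n hn
    rw [lqNorm_le_iff_of_ne_top hq h] at hn
    exact (ENNReal.sum_le_tsum I).trans hn

theorem tendsto_lqNorm_compl_zero {q : ℝ≥0∞} (hq : 1 ≤ q) (hq' : q ≠ ⊤) {a : ι → ℝ≥0∞}
    (ha : lqNorm q a ≠ ⊤) :
    Tendsto (fun I : Finset ι => lqNorm q (indicator (I : Set ι)ᶜ a)) atTop (𝓝 0) := by
  have h0 := toReal_pos_of_one_le hq hq'
  have hsum : ∑' i, a i ^ q.toReal ≠ ⊤ := by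
    intro h
    rw [lqNorm_of_ne_top hq', h] at ha
    exact ha (ENNReal.top_rpow_of_pos (by positivity))
  have h1 := (ENNReal.continuous_rpow_const (y := 1 / q.toReal)).tendsto 0 |>.comp
    (ENNReal.tendsto_tsum_compl_atTop_zero hsum)
  rw [ENNReal.zero_rpow_of_pos (by positivity)] at h1
  refine h1.congr fun I => ?_
  rw [lqNorm_of_ne_top hq', comp_apply]
  congr 1
  refine (tsum_subtype (I : Set ι)ᶜ (fun i => a i ^ q.toReal)).trans ?_
  congr 1
  ext i
  by_cases hi : i ∈ I <;> simp [hi, h0]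

/-- The converse of Hölder's inequality for sequences. -/
theorem lqNorm_le_of_forall_sum_mul_le {q q' : ℝ≥0∞} (h : q.HolderConjugate q') (hq : q ≠ ⊤)
    {a : ι → ℝ≥0∞} (ha : ∀ i, a i ≠ ⊤) {K : ℝ≥0∞}
    (hK : ∀ (I : Finset ι) (b : ι → ℝ≥0∞), (∀ i, b i ≠ ⊤) →
      ∑ i ∈ I, b i * a i ≤ K * lqNorm q (indicator (I : Set ι) b)) : lqNorm q' a ≤ K := by
  classical
  have h1 := h.one_le
  have h1' := h.symm.one_le
  by_cases h2 : q' = ⊤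
  · subst h2
    rw [lqNorm_top]
    refine iSup_le fun i => ?_
    refine (le_of_eq (by simp)).trans ((hK {i} (fun _ => 1) (by simp)).trans ?_)
    refine (mul_le_mul_right (lqNorm_le_tsum h1 _) _).trans ?_
    rw [tsum_eq_single i (fun j hj => by simp [hj])]
    simp
  · have hpq : q.toReal.HolderConjugate q'.toReal := holderConjugate_toReal h hq h2
    have hp0 := hpq.pos
    have hp0' := hpq.symm.pos
    rw [lqNorm_le_iff_of_ne_top h1' h2, ENNReal.tsum_eq_iSup_sum]
    refine iSup_le fun I => ?_
    set S := ∑ i ∈ I, a i ^ q'.toReal with hS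
    have hSt : S ≠ ⊤ := ENNReal.sum_ne_top.2 fun i _ =>
      ENNReal.rpow_ne_top_of_nonneg hp0'.le (ha i)
    rcases eq_or_ne S 0 with h0 | h0
    · rw [h0]
      exact zero_le
    have hkey : S ≤ K * S ^ (1 / q.toReal) := by
      have := hK I (fun i => a i ^ (q'.toReal - 1)) fun i =>
        ENNReal.rpow_ne_top_of_nonneg (by linarith [hpq.symm.lt]) (ha i)
      convert! this using 1
      · refine Finset.sum_congr rfl fun i _ => ?_
        nth_rewrite 3 [← ENNReal.rpow_one (a i)]
        rw [← ENNReal.rpow_add_of_nonneg _ _ (by linarith [hpq.symm.lt]) zero_le_one]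
        ring_nf
      · rw [lqNorm_of_ne_top hq, tsum_eq_sum (s := I) fun i hi => by simp [hi, hp0]]
        congr 2
        refine Finset.sum_congr rfl fun i hi => ?_
        rw [indicator_of_mem (by simpa using hi), ← ENNReal.rpow_mul, hpq.symm.sub_one_mul_conj]
    have h3 : S ^ (1 / q'.toReal) ≤ K := by
      have hS1 : S ^ (1 / q.toReal) ≠ 0 := by simp [h0, hSt]
      have hS2 : S ^ (1 / q.toReal) ≠ ⊤ := ENNReal.rpow_ne_top_of_nonneg (by positivity) hSt
      refine (ENNReal.mul_le_mul_iff_left hS1 hS2).1 (le_trans (le_of_eq ?_) hkey)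
      rw [← ENNReal.rpow_add _ _ h0 hSt]
      have := hpq.symm.inv_add_inv_eq_one
      rw [one_div, one_div, this, ENNReal.rpow_one]
    rwa [one_div, ENNReal.rpow_inv_le_iff hp0'] at h3

end Sequences

/-! ### The dual of `L^p` over a finite measure -/

section LpDual

variable {α : Type*} [MeasurableSpace α] {μ : Measure α} {p p' : ℝ≥0∞} [Fact (1 ≤ p)]

theorem hasSum_indicatorConstLp [IsFiniteMeasure μ] (hp : p ≠ ⊤) {A : ℕ → Set α}
    (hA : ∀ n, MeasurableSet (A n)) (hdisj : Pairwise (Disjoint on A)) (c : ℂ) :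
    HasSum (fun n => indicatorConstLp p (hA n) (measure_ne_top μ _) c)
      (indicatorConstLp p (MeasurableSet.iUnion hA) (measure_ne_top μ _) c) := by
  classical
  have hsum : ∀ s : Finset ℕ, ∑ n ∈ s, indicatorConstLp p (hA n) (measure_ne_top μ _) c =
      indicatorConstLp p (s.measurableSet_biUnion fun n _ => hA n) (measure_ne_top μ _) c := by
    intro s
    induction s using Finset.induction_on with
    | empty => simp
    | insert n s hn ih =>
      rw [Finset.sum_insert hn, ih, ← indicatorConstLp_disjoint_union]
      · congr 1
        simp
      · rw [disjoint_iUnion₂_right]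
        exact fun m hm => hdisj fun h => hn (h ▸ hm)
  rw [HasSum]
  simp_rw [hsum]
  refine tendsto_indicatorConstLp_set hp ?_
  have hfin : ∑' n, μ (A n) ≠ ⊤ := by
    rw [← measure_iUnion hdisj hA]
    exact measure_ne_top μ _
  refine tendsto_of_tendsto_of_tendsto_of_le_of_le tendsto_const_nhds
    (ENNReal.tendsto_tsum_compl_atTop_zero hfin) (fun _ => zero_le) fun s => ?_
  refine (measure_mono ?_).trans (measure_iUnion_le fun n : {n // n ∉ s} => A n)
  rintro y (⟨h1, h2⟩ | ⟨h1, h2⟩)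
  · exact absurd (iUnion₂_subset_iUnion _ _ h1) h2
  · obtain ⟨n, hn⟩ := mem_iUnion.1 h1
    refine mem_iUnion.2 ⟨⟨n, fun hs => h2 (mem_iUnion₂.2 ⟨n, hs, hn⟩)⟩, hn⟩

/-- The Radon–Nikodym density of a functional on `L^p`. -/
theorem exists_integrable_density [IsFiniteMeasure μ] (hp : p ≠ ⊤) (Λ : Lp ℂ p μ →L[ℂ] ℂ) :
    ∃ h : α → ℂ, Integrable h μ ∧ StronglyMeasurable h ∧ ∀ (A : Set α) (hA : MeasurableSet A),
      Λ (indicatorConstLp p hA (measure_ne_top μ A) 1) = ∫ y in A, h y ∂μ := by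
  classical
  let ν : ComplexMeasure α :=
    { measureOf' := fun A => if hA : MeasurableSet A then
        Λ (indicatorConstLp p hA (measure_ne_top μ A) 1) else 0
      empty' := by simp
      not_measurable' := fun A hA => dif_neg hA
      m_iUnion' := fun A hA hdisj => by
        simp only [hA, MeasurableSet.iUnion hA, dif_pos]
        exact Λ.hasSum (hasSum_indicatorConstLp hp hA hdisj 1) }
  have hν : ∀ (A : Set α) (hA : MeasurableSet A),
      ν A = Λ (indicatorConstLp p hA (measure_ne_top μ A) 1) := fun A hA => dif_pos hA
  have hac : ∀ (A : Set α), MeasurableSet A → μ A = 0 → ν A = 0 := fun A hA h0 => by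
    rw [hν A hA, show indicatorConstLp p hA (measure_ne_top μ A) (1 : ℂ) = 0 from ?_, map_zero]
    rw [← norm_eq_zero]
    refine le_antisymm (norm_indicatorConstLp_le.trans ?_) (norm_nonneg _)
    have : 0 < p.toReal := toReal_pos_of_one_le Fact.out hp
    simp [measureReal_def, h0, this.ne']
  have hre : ν.re ≪ᵥ μ.toENNRealVectorMeasure := by
    refine VectorMeasure.AbsolutelyContinuous.mk fun A hA h0 => ?_
    rw [Measure.toENNRealVectorMeasure_apply_measurable hA] at h0
    change (ν A).re = 0
    rw [hac A hA h0, Complex.zero_re]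
  have him : ν.im ≪ᵥ μ.toENNRealVectorMeasure := by
    refine VectorMeasure.AbsolutelyContinuous.mk fun A hA h0 => ?_
    rw [Measure.toENNRealVectorMeasure_apply_measurable hA] at h0
    change (ν A).im = 0
    rw [hac A hA h0, Complex.zero_im]
  have hint := ν.integrable_rnDeriv μ
  refine ⟨ν.rnDeriv μ, hint, ?_, fun A hA => ?_⟩
  · refine Measurable.stronglyMeasurable ?_
    exact Complex.measurableEquivRealProd.symm.measurable.comp
      ((SignedMeasure.measurable_rnDeriv _ _).prodMk (SignedMeasure.measurable_rnDeriv _ _))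
  · rw [← hν A hA]
    have h1 := congrArg (fun m : SignedMeasure α => m A)
      (SignedMeasure.withDensityᵥ_rnDeriv_eq ν.re μ hre)
    have h2 := congrArg (fun m : SignedMeasure α => m A)
      (SignedMeasure.withDensityᵥ_rnDeriv_eq ν.im μ him)
    simp only [withDensityᵥ_apply (SignedMeasure.integrable_rnDeriv _ _) hA] at h1 h2
    apply Complex.ext
    · rw [← RCLike.re_eq_complex_re, ← integral_re hint.integrableOn]
      exact h1.symm
    · rw [← RCLike.im_eq_complex_im, ← integral_im hint.integrableOn]
      exact h2.symm

/-- A functional given by integration against `h` on indicators is so on all of `L^p`. -/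
theorem lp_pairing_eq_of_indicator [IsFiniteMeasure μ] (hpp : p.HolderConjugate p') (hp : p ≠ ⊤)
    (Λ : Lp ℂ p μ →L[ℂ] ℂ) {h : α → ℂ} (hh : MemLp h p' μ)
    (hΛ : ∀ (A : Set α) (hA : MeasurableSet A),
      Λ (indicatorConstLp p hA (measure_ne_top μ A) 1) = ∫ y in A, h y ∂μ) (u : Lp ℂ p μ) :
    Λ u = ∫ y, h y * u y ∂μ := by
  have : Fact (1 ≤ p') := ⟨hpp.symm.one_le⟩
  have := hpp.symm
  set B := (ContinuousLinearMap.mul ℂ ℂ).lpPairing μ p' p (hh.toLp h) with hB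
  have hBu : ∀ u : Lp ℂ p μ, B u = ∫ y, h y * u y ∂μ := fun u => by
    rw [hB, ContinuousLinearMap.lpPairing_eq_integral]
    refine integral_congr_ae ?_
    filter_upwards [hh.coeFn_toLp] with y hy
    simp [hy]
  rw [← hBu]
  refine Lp.induction hp (fun u => Λ u = B u) ?_ ?_ ?_ u
  · intro c A hA hμA
    have h1 : (Lp.simpleFunc.indicatorConst p hA hμA.ne c : Lp ℂ p μ) =
        c • indicatorConstLp p hA (measure_ne_top μ A) 1 := by
      rw [Lp.simpleFunc.coe_indicatorConst]
      ext1
      filter_upwards [Lp.coeFn_smul c (indicatorConstLp p hA (measure_ne_top μ A) (1 : ℂ)),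
        indicatorConstLp_coeFn (p := p) (hs := hA) (hμs := measure_ne_top μ A) (c := (1 : ℂ)),
        indicatorConstLp_coeFn (p := p) (hs := hA) (hμs := measure_ne_top μ A) (c := c)]
        with y h1 h2 h3
      rw [h1, h3, Pi.smul_apply, h2]
      by_cases hy : y ∈ A <;> simp [hy]
    change Λ (Lp.simpleFunc.indicatorConst p hA hμA.ne c : Lp ℂ p μ) = B _
    rw [h1, map_smul, map_smul, hΛ A hA, hBu, ← integral_indicator hA]
    congr 1
    refine integral_congr_ae ?_
    filter_upwards [indicatorConstLp_coeFn (p := p) (hs := hA) (hμs := measure_ne_top μ A)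
      (c := (1 : ℂ))] with y hy
    rw [hy]
    by_cases hyA : y ∈ A <;> simp [hyA]
  · intro f g hf hg _ h1 h2
    rw [map_add, map_add, h1, h2]
  · exact isClosed_eq Λ.continuous B.continuous

/-- The `L^{p'}` norm of a density is at most the norm of the functional it induces on `L^p`. -/
theorem eLpNorm_le_of_lp_pairing [IsFiniteMeasure μ] (hpp : p.HolderConjugate p') (hp : p ≠ ⊤)
    (Λ : Lp ℂ p μ →L[ℂ] ℂ) {h : α → ℂ} (hh : MemLp h p' μ)
    (hΛ : ∀ u : Lp ℂ p μ, Λ u = ∫ y, h y * u y ∂μ) : eLpNorm h p' μ ≤ ‖Λ‖ₑ := by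
  have key : ∀ (u : α → ℂ) (hu : MemLp u p μ), ‖∫ y, h y * u y ∂μ‖ₑ ≤ ‖Λ‖ₑ * eLpNorm u p μ := by
    intro u hu
    have h1 : ∫ y, h y * u y ∂μ = Λ (hu.toLp u) := by
      rw [hΛ]
      refine integral_congr_ae ?_
      filter_upwards [hu.coeFn_toLp] with y hy
      rw [hy]
    rw [h1, ← Lp.enorm_toLp hu]
    exact Λ.le_opENorm _
  by_cases hp' : p' = ⊤
  · subst hp'
    have := hpp.symm
    obtain rfl : p = 1 := (ENNReal.HolderConjugate.eq_top_iff_eq_one ⊤ p).1 rfl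
    have hint : Integrable h μ := (memLp_one_iff_integrable.1 (hh.mono_exponent le_top))
    have h1 : (fun y => ‖h y‖) ≤ᵐ[μ] fun _ => ‖Λ‖ := by
      refine ae_le_of_forall_setIntegral_le hint.norm (integrable_const _) fun A hA _ => ?_
      -- testing with the conjugate phase of `h` on `A`
      set u : α → ℂ := A.indicator fun y => (starRingEnd ℂ) (h y) / ‖h y‖ with hu
      have hub : ∀ y, ‖u y‖ₑ ≤ A.indicator (fun _ => (1 : ℝ≥0∞)) y := fun y => by
        by_cases hy : y ∈ A
        · simp only [hu, hy, indicator_of_mem]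
          rw [← ofReal_norm, ENNReal.ofReal_le_one]
          simp [div_self_le_one]
        · simp [hu, hy]
      have hum : AEStronglyMeasurable u μ := by
        refine AEStronglyMeasurable.indicator ?_ hA
        exact ((Complex.continuous_conj.comp_aestronglyMeasurable hh.1).aemeasurable.div
          (Complex.measurable_ofReal.comp_aemeasurable hh.1.norm.aemeasurable)).aestronglyMeasurable
      have hun : eLpNorm u 1 μ ≤ μ A := by
        rw [eLpNorm_one_eq_lintegral_enorm]
        refine (lintegral_mono hub).trans_eq ?_
        rw [lintegral_indicator hA, setLIntegral_one]
      have h2 := key u ⟨hum, hun.trans_lt (measure_lt_top μ A)⟩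
      have h3 : ∫ y, h y * u y ∂μ = ((∫ y in A, ‖h y‖ ∂μ : ℝ) : ℂ) := by
        rw [← integral_complex_ofReal, ← integral_indicator hA]
        congr 1
        ext1 y
        by_cases hy : y ∈ A
        · simp only [hu, hy, indicator_of_mem]
          rcases eq_or_ne (h y) 0 with h0 | h0
          · simp [h0]
          · have : (‖h y‖ : ℂ) ≠ 0 := by simpa using h0
            rw [mul_div_assoc', Complex.mul_conj']
            field_simp
        · simp [hu, hy]
      rw [h3] at h2
      rw [setIntegral_const, smul_eq_mul]
      have h4 := h2.trans (mul_le_mul_right hun _)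
      rw [← ofReal_norm, Complex.norm_real, Real.norm_of_nonneg (by positivity)] at h4
      rw [ENNReal.ofReal_le_iff_le_toReal (by finiteness), ENNReal.toReal_mul, toReal_enorm] at h4
      rw [measureReal_def, mul_comm]
      exact h4
    rw [eLpNorm_exponent_top]
    refine eLpNormEssSup_le_of_ae_enorm_bound ?_
    filter_upwards [h1] with y hy
    rw [← ofReal_norm, ← ofReal_norm]
    exact ENNReal.ofReal_le_ofReal hy
  · have hpq := holderConjugate_toReal hpp hp hp'
    set r := p.toReal
    set r' := p'.toReal
    have hr0 : 0 < r := hpq.pos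
    have hr0' : 0 < r' := hpq.symm.pos
    have hp0 : p ≠ 0 := hpp.ne_zero
    have hp0' : p' ≠ 0 := hpp.symm.ne_zero
    -- the extremal function of Hölder's inequality: `h u = |h|^{r'}` and `|u|^r = |h|^{r'}`
    set u : α → ℂ := fun y => (starRingEnd ℂ) (h y) * ((‖h y‖ ^ (r' - 2) : ℝ) : ℂ) with hu
    have hum : AEStronglyMeasurable u μ :=
      (Complex.continuous_conj.comp_aestronglyMeasurable hh.1).mul
        (Complex.measurable_ofReal.comp_aemeasurable
          (hh.1.norm.aemeasurable.pow_const _)).aestronglyMeasurable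
    have hnorm : ∀ y, ‖u y‖ = ‖h y‖ ^ (r' - 1) := fun y => by
      rcases eq_or_ne (h y) 0 with h0 | h0
      · simp [hu, h0, Real.zero_rpow (by linarith [hpq.symm.lt] : r' - 1 ≠ 0)]
      · have : 0 < ‖h y‖ := norm_pos_iff.2 h0
        simp only [hu, norm_mul, RCLike.norm_conj, Complex.norm_real]
        rw [Real.norm_of_nonneg (by positivity)]
        nth_rewrite 1 [← Real.rpow_one ‖h y‖]
        rw [← Real.rpow_add this]
        ring_nf
    have henorm : ∀ y, ‖u y‖ₑ ^ r = ‖h y‖ₑ ^ r' := fun y => by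
      rw [← ofReal_norm, ← ofReal_norm, hnorm, ENNReal.ofReal_rpow_of_nonneg (by positivity) hr0.le,
        ENNReal.ofReal_rpow_of_nonneg (by positivity) hr0'.le, ← Real.rpow_mul (by positivity),
        hpq.symm.sub_one_mul_conj]
    set S := ∫⁻ y, ‖h y‖ₑ ^ r' ∂μ with hS
    have hS1 : eLpNorm u p μ = S ^ (1 / r) := by
      rw [eLpNorm_eq_lintegral_rpow_enorm_toReal hp0 hp]
      simp_rw [show p.toReal = r from rfl, henorm, hS]
    have hS2 : eLpNorm h p' μ = S ^ (1 / r') := eLpNorm_eq_lintegral_rpow_enorm_toReal hp0' hp'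
    have hSt : S ≠ ⊤ := (lintegral_rpow_enorm_lt_top_of_eLpNorm_lt_top hp0' hp' hh.2).ne
    have h2 := key u ⟨hum, by
      rw [hS1]; exact (ENNReal.rpow_ne_top_of_nonneg (by positivity) hSt).lt_top⟩
    have h3 : ‖∫ y, h y * u y ∂μ‖ₑ = S := by
      have h4 : ∀ y, h y * u y = ((‖h y‖ ^ r' : ℝ) : ℂ) := fun y => by
        rcases eq_or_ne (h y) 0 with h0 | h0
        · simp [h0, Real.zero_rpow hr0'.ne']
        · have : 0 < ‖h y‖ := norm_pos_iff.2 h0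
          simp only [hu]
          rw [← mul_assoc, Complex.mul_conj']
          norm_cast
          rw [← Real.rpow_natCast, ← Real.rpow_add this]
          congr 1
          push_cast
          ring
      simp_rw [h4]
      rw [integral_complex_ofReal, ← ofReal_norm, Complex.norm_real,
        Real.norm_of_nonneg (integral_nonneg fun y => by positivity),
        ofReal_integral_eq_lintegral_ofReal]
      · refine lintegral_congr fun y => ?_
        rw [← ofReal_norm, ENNReal.ofReal_rpow_of_nonneg (by positivity) hr0'.le]
      · exact hh.integrable_norm_rpow hp0' hp'
      · exact ae_of_all _ fun y => by positivity
    rw [h3, hS1] at h2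
    rw [hS2]
    rcases eq_or_ne S 0 with h0 | h0
    · rw [h0, ENNReal.zero_rpow_of_pos (by positivity)]
      exact zero_le
    have hS3 : S ^ (1 / r) ≠ 0 := by simp [h0, hSt]
    have hS4 : S ^ (1 / r) ≠ ⊤ := ENNReal.rpow_ne_top_of_nonneg (by positivity) hSt
    refine (ENNReal.mul_le_mul_iff_left hS3 hS4).1 (le_trans (le_of_eq ?_) h2)
    rw [← ENNReal.rpow_add _ _ h0 hSt, one_div, one_div, hpq.symm.inv_add_inv_eq_one,
      ENNReal.rpow_one]

/-- Riesz representation: every continuous functional on `L^p`, `p < ∞`, over a finite measure is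
integration against an `L^{p'}` function. -/
theorem exists_memLp_eq_integral_mul [IsFiniteMeasure μ] (hpp : p.HolderConjugate p')
    (hp : p ≠ ⊤) (Λ : Lp ℂ p μ →L[ℂ] ℂ) :
    ∃ h : α → ℂ, MemLp h p' μ ∧ eLpNorm h p' μ ≤ ‖Λ‖ₑ ∧
      ∀ u : Lp ℂ p μ, Λ u = ∫ y, h y * u y ∂μ := by
  obtain ⟨h, hint, hmeas, hΛ⟩ := exists_integrable_density hp Λ
  have hA : ∀ n : ℕ, MeasurableSet {y | ‖h y‖ ≤ n} := fun n =>
    measurableSet_le hmeas.norm.measurable measurable_const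
  -- truncation is a contraction of `L^p` and makes the density bounded
  have hbound : ∀ n : ℕ, eLpNorm ({y | ‖h y‖ ≤ n}.indicator h) p' μ ≤ ‖Λ‖ₑ := by
    intro n
    have hmem : MemLp ({y | ‖h y‖ ≤ n}.indicator h) p' μ := by
      refine MemLp.of_bound (hmeas.indicator (hA n)).aestronglyMeasurable n
        (ae_of_all _ fun y => ?_)
      by_cases hy : ‖h y‖ ≤ n <;> simp [indicator, hy]
    set M := (ContinuousLinearMap.mul ℂ ℂ).holderL μ ⊤ p p
      (indicatorConstLp ⊤ (hA n) (measure_ne_top μ _) 1) with hM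
    have hMu : ∀ u : Lp ℂ p μ, M u =ᵐ[μ] {y | ‖h y‖ ≤ n}.indicator u := fun u => by
      filter_upwards [(ContinuousLinearMap.mul ℂ ℂ).coeFn_holder (r := p)
        (indicatorConstLp ⊤ (hA n) (measure_ne_top μ _) 1) u,
        indicatorConstLp_coeFn (p := ⊤) (hs := hA n) (hμs := measure_ne_top μ _)
        (c := (1 : ℂ))] with y hy1 hy2
      refine hy1.trans ?_
      rw [hy2]
      by_cases hy : ‖h y‖ ≤ n <;> simp [indicator, hy]
    have hMle : ‖M‖ ≤ 1 := by
      refine ContinuousLinearMap.opNorm_le_bound _ zero_le_one fun u => ?_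
      rw [one_mul]
      refine Lp.norm_le_norm_of_ae_le ?_
      filter_upwards [hMu u] with y hy
      rw [hy]
      exact norm_indicator_le_norm_self _ _
    have h1 : ∀ (A : Set α) (hA' : MeasurableSet A),
        (Λ ∘L M) (indicatorConstLp p hA' (measure_ne_top μ A) 1) =
          ∫ y in A, {y | ‖h y‖ ≤ n}.indicator h y ∂μ := fun A hA' => by
      rw [setIntegral_indicator (hA n), ← hΛ _ (hA'.inter (hA n)), ContinuousLinearMap.comp_apply]
      congr 1
      ext1
      filter_upwards [hMu (indicatorConstLp p hA' (measure_ne_top μ A) 1),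
        indicatorConstLp_coeFn (p := p) (hs := hA') (hμs := measure_ne_top μ A) (c := (1 : ℂ)),
        indicatorConstLp_coeFn (p := p) (hs := hA'.inter (hA n))
        (hμs := measure_ne_top μ _) (c := (1 : ℂ))] with y hy1 hy2 hy3
      rw [hy1, hy3, inter_comm, ← indicator_indicator]
      by_cases hy : ‖h y‖ ≤ n <;> simp [indicator, hy, hy2]
    refine (eLpNorm_le_of_lp_pairing hpp hp (Λ ∘L M) hmem
      (lp_pairing_eq_of_indicator hpp hp _ hmem h1)).trans ?_
    rw [← ofReal_norm, ← ofReal_norm]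
    refine ENNReal.ofReal_le_ofReal ((Λ.opNorm_comp_le M).trans ?_)
    exact mul_le_of_le_one_right (norm_nonneg _) hMle
  have hle : eLpNorm h p' μ ≤ ‖Λ‖ₑ := by
    refine (Lp.eLpNorm_lim_le_liminf_eLpNorm
      (fun n => (hmeas.indicator (hA n)).aestronglyMeasurable) h (ae_of_all _ fun y => ?_)).trans ?_
    · refine tendsto_const_nhds.congr' ?_
      obtain ⟨N, hN⟩ := exists_nat_ge ‖h y‖
      filter_upwards [eventually_ge_atTop N] with n hn
      have : ‖h y‖ ≤ n := hN.trans (by exact_mod_cast hn)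
      simp [indicator, this]
    · exact (liminf_le_liminf (Eventually.of_forall hbound)).trans (by simp)
  have hmem : MemLp h p' μ := ⟨hmeas.aestronglyMeasurable, hle.trans_lt enorm_lt_top⟩
  exact ⟨h, hmem, hle, lp_pairing_eq_of_indicator hpp hp Λ hmem hΛ⟩

end LpDual

/-! ### Density of the compactly supported functions in the Schwartz space -/

section SchwartzDense

variable {E : Type*} [NormedAddCommGroup E] [NormedSpace ℝ E]

theorem norm_iteratedFDeriv_comp_smul_le {G : E → ℂ} (hG : ContDiff ℝ ∞ G) {ε : ℝ} (hε : 0 ≤ ε)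
    (hε1 : ε ≤ 1) {j : ℕ} {C : ℝ} (hC : ∀ y, ‖iteratedFDeriv ℝ j G y‖ ≤ C) (y : E) :
    ‖iteratedFDeriv ℝ j (fun z => G (ε • z)) y‖ ≤ C := by
  set L : E →L[ℝ] E := ε • ContinuousLinearMap.id ℝ E with hL
  have hLn : ‖L‖ ≤ 1 := by
    rw [hL, norm_smul, Real.norm_of_nonneg hε]
    exact mul_le_one₀ hε1 (norm_nonneg _) ContinuousLinearMap.norm_id_le
  have h1 : (fun z => G (ε • z)) = G ∘ L := rfl
  rw [h1, L.iteratedFDeriv_comp_right hG y (by exact_mod_cast le_top)]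
  refine (ContinuousMultilinearMap.norm_compContinuousLinearMap_le _ _).trans ?_
  have hC0 : 0 ≤ C := (norm_nonneg _).trans (hC 0)
  calc _ ≤ C * 1 := by
        gcongr
        · exact hC _
        · exact Finset.prod_le_one (fun _ _ => norm_nonneg _) fun _ _ => hLn
    _ = C := mul_one C

/-- Two functionals on the Schwartz space agree if they agree on compactly supported functions:
the dilated cut-offs `χ(ε ·) φ` converge to `φ` as `ε → 0`. -/
theorem schwartz_functional_ext [FiniteDimensional ℝ E] {f g : 𝓢(E, ℂ) → ℂ}
    (hf : Continuous f) (hg : Continuous g)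
    (h : ∀ φ : 𝓢(E, ℂ), HasCompactSupport φ → f φ = g φ) (φ : 𝓢(E, ℂ)) : f φ = g φ := by
  let b : ContDiffBump (0 : E) := ⟨1, 2, one_pos, one_lt_two⟩
  set χ : E → ℂ := fun y => (b y : ℂ) with hχ
  have hχs : ContDiff ℝ ∞ χ := Complex.ofRealCLM.contDiff.comp b.contDiff
  have hχc : HasCompactSupport χ := b.hasCompactSupport.comp_left (g := Complex.ofReal) rfl
  set G : E → ℂ := fun y => 1 - χ y with hG
  have hGs : ContDiff ℝ ∞ G := contDiff_const.sub hχs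
  have hGb : ∀ j, ∃ C, ∀ y, ‖iteratedFDeriv ℝ j G y‖ ≤ C := fun j => by
    have h1 : Continuous fun y => ‖iteratedFDeriv ℝ j χ y‖ :=
      (hχs.continuous_iteratedFDeriv (by exact_mod_cast le_top)).norm
    obtain ⟨y₀, hy₀⟩ := h1.exists_forall_ge_of_hasCompactSupport ((hχc.iteratedFDeriv j).norm)
    refine ⟨1 + ‖iteratedFDeriv ℝ j χ y₀‖, fun y => ?_⟩
    have h2 : iteratedFDeriv ℝ j G y =
        iteratedFDeriv ℝ j (fun _ : E => (1 : ℂ)) y - iteratedFDeriv ℝ j χ y :=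
      iteratedFDeriv_sub_apply (contDiff_const.contDiffAt)
        (hχs.contDiffAt.of_le (by exact_mod_cast le_top))
    rw [h2]
    refine (norm_sub_le _ _).trans (add_le_add ?_ (hy₀ y))
    rcases j with _ | j
    · simp
    · simp [iteratedFDeriv_const_of_ne (𝕜 := ℝ) (Nat.succ_ne_zero j) (1 : ℂ)]
  choose C hC using hGb
  set ε : ℕ → ℝ := fun n => 1 / ((n : ℝ) + 1) with hε
  have hε0 : ∀ n, 0 < ε n := fun n => by positivity
  have hε1 : ∀ n, ε n ≤ 1 := fun n => by
    rw [hε, div_le_one (by positivity)]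
    simp
  have hgs : ∀ n, ContDiff ℝ ∞ (fun y => χ (ε n • y)) := fun n =>
    hχs.comp (contDiff_const_smul (ε n))
  have hgc : ∀ n, HasCompactSupport (fun y => χ (ε n • y)) := fun n =>
    hχc.comp_smul (hε0 n).ne'
  have hgt : ∀ n, (fun y => χ (ε n • y)).HasTemperateGrowth := fun n =>
    (hgc n).hasTemperateGrowth (hgs n)
  set φn : ℕ → 𝓢(E, ℂ) := fun n => SchwartzMap.smulLeftCLM ℂ (fun y => χ (ε n • y)) φ with hφn
  have hφn_apply : ∀ n y, φn n y = χ (ε n • y) * φ y := fun n y => by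
    rw [hφn, SchwartzMap.smulLeftCLM_apply_apply (hgt n), smul_eq_mul]
  have hcomp : ∀ n, HasCompactSupport (φn n) := fun n => by
    have : (φn n : E → ℂ) = (fun y => χ (ε n • y)) * φ := funext fun y => hφn_apply n y
    rw [this]
    exact (hgc n).mul_right
  have hlim : Tendsto φn atTop (𝓝 φ) := by
    rw [(schwartz_withSeminorms ℂ E ℂ).tendsto_nhds]
    rintro ⟨k, m⟩ η hη
    set K : ℝ := ∑ j ∈ Finset.range (m + 1), (m.choose j : ℝ) * C j *
      SchwartzMap.seminorm ℂ (k + 1) (m - j) φ with hK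
    have hC0 : ∀ j, 0 ≤ C j := fun j => (norm_nonneg _).trans (hC j 0)
    have hK0 : 0 ≤ K := Finset.sum_nonneg fun j _ =>
      mul_nonneg (mul_nonneg (Nat.cast_nonneg _) (hC0 j)) (apply_nonneg _ _)
    have hbound : ∀ n, SchwartzMap.seminorm ℂ k m (φn n - φ) ≤ ε n * K := fun n => by
      refine SchwartzMap.seminorm_le_bound ℂ k m _ (mul_nonneg (hε0 n).le hK0) fun y => ?_
      have hfun : ((φn n - φ : 𝓢(E, ℂ)) : E → ℂ) = -fun y => G (ε n • y) * φ y := by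
        ext z
        rw [sub_apply, hφn_apply]
        simp only [hG, Pi.neg_apply]
        ring
      rw [hfun, iteratedFDeriv_neg_apply, norm_neg]
      by_cases hy : ‖ε n • y‖ < 1
      · have hev : (fun y => G (ε n • y) * φ y) =ᶠ[𝓝 y] fun _ => 0 := by
          have hcont : Continuous fun z : E => ‖ε n • z‖ := by fun_prop
          filter_upwards [hcont.tendsto y |>.eventually_lt_const hy] with z hz
          have : b (ε n • z) = 1 := b.one_of_mem_closedBall (by simpa using hz.le)
          simp [hG, hχ, this]
        rw [(hev.iteratedFDeriv ℝ m).eq_of_nhds]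
        have h0 : iteratedFDeriv ℝ m (fun _ : E => (0 : ℂ)) y = 0 := by
          simp
        rw [h0, norm_zero, mul_zero]
        exact mul_nonneg (hε0 n).le hK0
      · rw [not_lt, norm_smul, Real.norm_of_nonneg (hε0 n).le] at hy
        have hGn : ContDiff ℝ ∞ (fun y => G (ε n • y)) := hGs.comp (contDiff_const_smul (ε n))
        have hmul := norm_iteratedFDeriv_mul_le (𝕜 := ℝ) hGn (φ.smooth ⊤) y (n := m)
          (by exact_mod_cast le_top)
        calc ‖y‖ ^ k * ‖iteratedFDeriv ℝ m (fun y => G (ε n • y) * φ y) y‖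
            ≤ (ε n * ‖y‖) * (‖y‖ ^ k * ∑ j ∈ Finset.range (m + 1), (m.choose j : ℝ) *
              ‖iteratedFDeriv ℝ j (fun y => G (ε n • y)) y‖ *
              ‖iteratedFDeriv ℝ (m - j) φ y‖) := by
              refine le_trans ?_ (le_mul_of_one_le_left ?_ hy)
              · gcongr
              · positivity
          _ = ε n * ∑ j ∈ Finset.range (m + 1), (m.choose j : ℝ) *
              ‖iteratedFDeriv ℝ j (fun y => G (ε n • y)) y‖ *
              (‖y‖ ^ (k + 1) * ‖iteratedFDeriv ℝ (m - j) φ y‖) := by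
              rw [Finset.mul_sum, Finset.mul_sum, Finset.mul_sum]
              refine Finset.sum_congr rfl fun j _ => ?_
              ring
          _ ≤ ε n * K := by
              rw [hK]
              gcongr with j _
              · exact mul_nonneg (Nat.cast_nonneg _) (hC0 j)
              · exact norm_iteratedFDeriv_comp_smul_le hGs (hε0 n).le (hε1 n) (hC j) y
              · exact SchwartzMap.le_seminorm ℂ _ _ φ y
    have hε_lim : Tendsto (fun n => ε n * K) atTop (𝓝 0) := by
      simpa [hε] using tendsto_one_div_add_atTop_nhds_zero_nat.mul_const K
    filter_upwards [hε_lim.eventually_lt_const hη] with n hn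
    exact (hbound n).trans_lt hn
  have h1 := (hf.tendsto φ).comp hlim
  have h2 := (hg.tendsto φ).comp hlim
  refine tendsto_nhds_unique h1 (h2.congr fun n => (h (φn n) (hcomp n)).symm)

end SchwartzDense

/-! ### Geometry of the covering -/

section Geometry

variable {d : ℕ} {ι : Type*} {U : ι → Set (Euc d)} {x : ι → Euc d}

/-- What the arguments below use of a structured covering: an open admissible covering on whose
members `1 + ‖y‖` is essentially constant, together with separated points of its members. -/
structure IsWeightedCovering (U : ι → Set (Euc d)) (x : ι → Euc d) : Prop where
  isOpen : ∀ i, IsOpen (U i)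
  admissible : IsAdmissibleCovering U
  separated : IsSeparatedFamily x
  mem : ∀ i, x i ∈ U i
  moderate : IsModerate U (fun y => 1 + ‖y‖)

theorem IsStructuredCovering.isWeightedCovering {T : ι → (Euc d ≃ᵃ[ℝ] Euc d)}
    {P Q : Set (Euc d)} (h : IsStructuredCovering T P Q x) :
    IsWeightedCovering (affineFamily T Q) x where
  isOpen i := (AffineEquiv.toContinuousAffineEquiv (T i)).toHomeomorph.isOpenMap _ h.isOpen_Q
  admissible := h.admissible_Q
  separated := h.separated
  mem := h.mem
  moderate := h.moderate

theorem one_le_weight (x : ι → Euc d) (i : ι) : 1 ≤ weight x i := by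
  simp [weight]

theorem weight_pos (x : ι → Euc d) (i : ι) : 0 < weight x i :=
  zero_lt_one.trans_le (one_le_weight x i)

theorem IsAdmissibleCovering.exists_neighbours (h : IsAdmissibleCovering U) :
    ∃ (N : ι → Finset ι) (n₀ : ℕ), (∀ i, (N i).card ≤ n₀) ∧
      ∀ i j, j ∈ N i ↔ (U j ∩ U i).Nonempty := by
  obtain ⟨n₀, hn₀⟩ := h.neighbours
  have hfin : ∀ i, {j | (U j ∩ U i).Nonempty}.Finite := fun i =>
    Set.finite_of_encard_le_coe (hn₀ i)
  refine ⟨fun i => (hfin i).toFinset, n₀, fun i => ?_, fun i j => by simp⟩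
  have := hn₀ i
  rw [(hfin i).encard_eq_coe_toFinset_card] at this
  exact_mod_cast this

theorem IsAdmissibleCovering.exists_mem (h : IsAdmissibleCovering U) (y : Euc d) :
    ∃ i, y ∈ U i := by
  have : y ∈ ⋃ i, U i := h.iUnion_eq ▸ mem_univ y
  simpa using this

theorem IsWeightedCovering.exists_weight_bound (h : IsWeightedCovering U x) :
    ∃ C : ℝ, 1 ≤ C ∧ ∀ i, ∀ y ∈ U i, weight x i ≤ C * (1 + ‖y‖) ∧ 1 + ‖y‖ ≤ C * weight x i := by
  obtain ⟨C, hC, hb⟩ := h.moderate.bound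
  refine ⟨max C 1, le_max_right _ _, fun i y hy => ⟨?_, ?_⟩⟩
  · exact (hb i _ (h.mem i) y hy).trans
      (mul_le_mul_of_nonneg_right (le_max_left _ _) (by positivity))
  · exact (hb i y hy _ (h.mem i)).trans
      (mul_le_mul_of_nonneg_right (le_max_left _ _) (by positivity))

theorem rpow_le_rpow_abs_mul {a b K s : ℝ} (ha : 0 < a) (hb : 0 < b) (hK : 1 ≤ K)
    (hab : a ≤ K * b) (hba : b ≤ K * a) : a ^ s ≤ K ^ |s| * b ^ s := by
  have hK0 : 0 < K := by linarith
  rcases le_total 0 s with hs | hs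
  · rw [abs_of_nonneg hs, ← Real.mul_rpow hK0.le hb.le]
    exact Real.rpow_le_rpow ha.le hab hs
  · rw [abs_of_nonpos hs]
    have h1 : b ^ (-s) ≤ K ^ (-s) * a ^ (-s) := by
      rw [← Real.mul_rpow hK0.le ha.le]
      exact Real.rpow_le_rpow hb.le hba (by linarith)
    have h2 : a ^ (-s) * a ^ s = 1 := by rw [← Real.rpow_add ha]; simp
    have h3 : b ^ (-s) * b ^ s = 1 := by rw [← Real.rpow_add hb]; simp
    calc a ^ s = (b ^ (-s) * b ^ s) * a ^ s := by rw [h3, one_mul]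
      _ ≤ ((K ^ (-s) * a ^ (-s)) * b ^ s) * a ^ s := by gcongr
      _ = K ^ (-s) * b ^ s * (a ^ (-s) * a ^ s) := by ring
      _ = K ^ (-s) * b ^ s := by rw [h2, mul_one]

theorem IsWeightedCovering.exists_weight_rpow_le (h : IsWeightedCovering U x) (s : ℝ) :
    ∃ C : ℝ, 0 ≤ C ∧ ∀ i j, (U j ∩ U i).Nonempty → weight x i ^ s ≤ C * weight x j ^ s := by
  obtain ⟨C, hC, hb⟩ := h.exists_weight_bound
  have hC0 : 0 ≤ C := by linarith
  refine ⟨(C * C) ^ |s|, by positivity, fun i j ⟨y, hyj, hyi⟩ => ?_⟩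
  refine rpow_le_rpow_abs_mul (weight_pos x i) (weight_pos x j)
    (one_le_mul_of_one_le_of_one_le hC hC) ?_ ?_
  · rw [mul_assoc]
    exact (hb i y hyi).1.trans (mul_le_mul_of_nonneg_left (hb j y hyj).2 hC0)
  · rw [mul_assoc]
    exact (hb j y hyj).1.trans (mul_le_mul_of_nonneg_left (hb i y hyi).2 hC0)

/-- The sum is compared with the integral of `(1 + ‖y‖)^{-(d+1)}` over the disjoint balls of radius
`δ / 2` around the points. -/
theorem IsSeparatedFamily.tsum_weight_rpow_ne_top [Countable ι] (h : IsSeparatedFamily x) :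
    ∑' i, ENNReal.ofReal (weight x i ^ (-((d : ℝ) + 1))) ≠ ⊤ := by
  obtain ⟨δ, hδ, hsep⟩ := h
  set r := δ / 2 with hr
  have hr0 : 0 < r := by positivity
  set v := volume (Metric.ball (0 : Euc d) r) with hv
  have hv0 : v ≠ 0 := (Metric.measure_ball_pos volume _ hr0).ne'
  have hvt : v ≠ ⊤ := measure_ball_lt_top.ne
  set c : ℝ≥0∞ := ENNReal.ofReal ((1 + r) ^ ((d : ℝ) + 1)) with hc
  have hdisj : Pairwise (Disjoint on fun i => Metric.ball (x i) r) := fun i j hij => by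
    refine Metric.ball_disjoint_ball ?_
    rw [dist_eq_norm]
    have := hsep i j hij
    linarith
  have hint : ∫⁻ y : Euc d, ENNReal.ofReal ((1 + ‖y‖) ^ (-((d : ℝ) + 1))) < ⊤ := by
    refine finite_integral_one_add_norm ?_
    simp
  have key : (∑' i, ENNReal.ofReal (weight x i ^ (-((d : ℝ) + 1)))) * v ≤
      c * ∫⁻ y : Euc d, ENNReal.ofReal ((1 + ‖y‖) ^ (-((d : ℝ) + 1))) := by
    rw [← ENNReal.tsum_mul_right]
    calc ∑' i, ENNReal.ofReal (weight x i ^ (-((d : ℝ) + 1))) * v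
        ≤ ∑' i, ∫⁻ y in Metric.ball (x i) r,
            c * ENNReal.ofReal ((1 + ‖y‖) ^ (-((d : ℝ) + 1))) := by
          refine ENNReal.tsum_le_tsum fun i => ?_
          rw [hv, ← Measure.addHaar_ball_center volume (x i), ← setLIntegral_const]
          refine setLIntegral_mono' measurableSet_ball fun y hy => ?_
          rw [hc, ← ENNReal.ofReal_mul (by positivity)]
          refine ENNReal.ofReal_le_ofReal ?_
          have h1 : 1 + ‖y‖ ≤ (1 + r) * weight x i := by
            have h2 : ‖y‖ ≤ ‖x i‖ + r := by
              have h3 : ‖y - x i‖ < r := by rwa [← dist_eq_norm]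
              have := norm_le_norm_add_norm_sub' y (x i)
              linarith
            unfold weight
            nlinarith [norm_nonneg (x i)]
          rw [Real.rpow_neg (weight_pos x i).le, Real.rpow_neg (by positivity),
            ← div_eq_mul_inv, le_div_iff₀ (by positivity), inv_mul_le_iff₀
            (Real.rpow_pos_of_pos (weight_pos x i) _), mul_comm,
            ← Real.mul_rpow (by positivity) (weight_pos x i).le]
          exact Real.rpow_le_rpow (by positivity) h1 (by positivity)
      _ = ∫⁻ y in ⋃ i, Metric.ball (x i) r,
            c * ENNReal.ofReal ((1 + ‖y‖) ^ (-((d : ℝ) + 1))) :=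
          (lintegral_iUnion (fun _ => measurableSet_ball) hdisj _).symm
      _ ≤ ∫⁻ y, c * ENNReal.ofReal ((1 + ‖y‖) ^ (-((d : ℝ) + 1))) := setLIntegral_le_lintegral _ _
      _ = _ := lintegral_const_mul' _ _ ENNReal.ofReal_ne_top
  intro htop
  rw [htop, ENNReal.top_mul hv0] at key
  exact (ENNReal.mul_lt_top ENNReal.ofReal_lt_top hint).ne (top_le_iff.1 key)

/-- Moderateness puts `U_i` into a ball around the origin of radius comparable to `ω_i`. -/
theorem IsWeightedCovering.exists_volume_le (h : IsWeightedCovering U x) :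
    ∃ K : ℝ, 0 ≤ K ∧ ∀ i, volume (U i) ≤ ENNReal.ofReal (K * weight x i ^ (d : ℝ)) := by
  obtain ⟨C, hC, hb⟩ := h.exists_weight_bound
  have hC0 : 0 ≤ C := by linarith
  set v := volume (Metric.ball (0 : Euc d) 1) with hv
  have hvt : v ≠ ⊤ := measure_ball_lt_top.ne
  refine ⟨C ^ d * v.toReal, by positivity, fun i => ?_⟩
  have hw := (weight_pos x i).le
  have hsub : U i ⊆ Metric.closedBall 0 (C * weight x i) := fun y hy => by
    rw [mem_closedBall_zero_iff]
    linarith [(hb i y hy).2]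
  refine (measure_mono hsub).trans ?_
  rw [Measure.addHaar_closedBall _ _ (by positivity), ← hv, Real.rpow_natCast, mul_assoc,
    mul_comm v.toReal, ← mul_assoc, ← mul_pow, ENNReal.ofReal_mul (by positivity),
    ENNReal.ofReal_toReal hvt]
  simp

theorem IsWeightedCovering.volume_ne_top (h : IsWeightedCovering U x) (i : ι) :
    volume (U i) ≠ ⊤ := by
  obtain ⟨K, -, hK⟩ := h.exists_volume_le
  exact ((hK i).trans_lt ENNReal.ofReal_lt_top).ne

end Geometry

/-! ### Partitions of unity and the norm of a Schwartz function -/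

section Partition

variable {d : ℕ} {ι : Type*} {U : ι → Set (Euc d)} {x : ι → Euc d} {ψ : ι → Euc d → ℝ}

theorem IsBAPU.le_one (h : IsBAPU U ψ) (i : ι) (y : Euc d) : ψ i y ≤ 1 :=
  le_hasSum (h.sum_eq_one y) i fun j _ => h.nonneg j y

theorem IsBAPU.enorm_le_one (h : IsBAPU U ψ) (i : ι) (y : Euc d) : ‖(ψ i y : ℂ)‖ₑ ≤ 1 := by
  rw [← ofReal_norm, Complex.norm_real, Real.norm_of_nonneg (h.nonneg i y), ENNReal.ofReal_le_one]
  exact h.le_one i y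

theorem IsBAPU.mem_of_ne_zero (h : IsBAPU U ψ) {i : ι} {y : Euc d} (hy : ψ i y ≠ 0) : y ∈ U i :=
  h.tsupport_subset i (subset_tsupport _ hy)

theorem IsBAPU.eq_zero_of_notMem (h : IsBAPU U ψ) {i : ι} {y : Euc d} (hy : y ∉ U i) :
    ψ i y = 0 := by
  by_contra h0
  exact hy (h.mem_of_ne_zero h0)

theorem IsBAPU.hasTemperateGrowth (h : IsBAPU U ψ) (i : ι) :
    (fun y => (ψ i y : ℂ)).HasTemperateGrowth := by
  refine HasCompactSupport.hasTemperateGrowth ?_ (Complex.ofRealCLM.contDiff.comp (h.contDiff i))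
  exact (h.hasCompactSupport i).comp_left (g := Complex.ofReal) rfl

theorem IsBAPU.continuous (h : IsBAPU U ψ) (i : ι) : Continuous fun y => (ψ i y : ℂ) :=
  Complex.continuous_ofReal.comp (h.contDiff i).continuous

theorem IsBAPU.sum_eq_one_of_subset (h : IsBAPU U ψ) {y : Euc d} {I : Finset ι}
    (hI : ∀ i, y ∈ U i → i ∈ I) : ∑ i ∈ I, (ψ i y : ℂ) = 1 := by
  have h1 : HasSum (fun i => ψ i y) (∑ i ∈ I, ψ i y) :=
    hasSum_sum_of_ne_finset_zero fun i hi => h.eq_zero_of_notMem fun hy => hi (hI i hy)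
  have h2 := h1.unique (h.sum_eq_one y)
  exact_mod_cast h2

theorem IsBAPU.eLpNorm_mul_le (h : IsBAPU U ψ) (i : ι) (F : Euc d → ℂ) (p : ℝ≥0∞) :
    eLpNorm (fun y => (ψ i y : ℂ) * F y) p volume ≤ eLpNorm F p volume := by
  refine eLpNorm_mono_enorm fun y => ?_
  rw [enorm_mul]
  exact mul_le_of_le_one_left' (h.enorm_le_one i y)

/-- The norm `‖ (ω_i^s ‖ψ_i F‖_{L^p})_i ‖_{ℓ^q}` of a function `F`. -/
noncomputable def funNorm (p q : ℝ≥0∞) (x : ι → Euc d) (ψ : ι → Euc d → ℝ) (s : ℝ)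
    (F : Euc d → ℂ) : ℝ≥0∞ :=
  lqNorm q fun i => ENNReal.ofReal (weight x i ^ s) *
    eLpNorm (fun y => (ψ i y : ℂ) * F y) p volume

theorem rpow_le_one_add (v : ℝ≥0∞) {θ : ℝ} (h0 : 0 ≤ θ) (h1 : θ ≤ 1) : v ^ θ ≤ 1 + v := by
  rcases le_total v 1 with hv | hv
  · exact (ENNReal.rpow_le_one hv h0).trans le_self_add
  · exact ((ENNReal.rpow_le_rpow_of_exponent_le hv h1).trans_eq (ENNReal.rpow_one v)).trans
      le_add_self

/-- A Schwartz function decays fast enough for its decomposition norm to be bounded by one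
Schwartz seminorm; no bound on derivatives of the partition is involved. -/
theorem exists_funNorm_schwartz_le [Countable ι] (hU : IsWeightedCovering U x)
    (hψ : IsBAPU U ψ) (s : ℝ) {p q : ℝ≥0∞} (hp : 1 ≤ p) (hq : 1 ≤ q) :
    ∃ (C : ℝ) (N : ℕ), 0 ≤ C ∧ ∀ φ : 𝓢(Euc d, ℂ), funNorm p q x ψ s φ ≤
      ENNReal.ofReal (C * (Finset.Iic (N, N)).sup (schwartzSeminormFamily ℂ (Euc d) ℂ) φ) := by
  obtain ⟨C, hC, hb⟩ := hU.exists_weight_bound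
  obtain ⟨K, hK, hvol⟩ := hU.exists_volume_le
  have hC0 : 0 ≤ C := by linarith
  obtain ⟨M, hM⟩ := exists_nat_ge (s + d + (d + 1))
  have hsum := hU.separated.tsum_weight_rpow_ne_top
  set S₀ := ∑' i, ENNReal.ofReal (weight x i ^ (-((d : ℝ) + 1))) with hS₀
  refine ⟨2 ^ M * C ^ M * (1 + K) * S₀.toReal, M, by positivity, fun φ => ?_⟩
  set S := (Finset.Iic (M, M)).sup (schwartzSeminormFamily ℂ (Euc d) ℂ) φ with hS
  have hS0 : 0 ≤ S := apply_nonneg _ _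
  have hdecay : ∀ y, (1 + ‖y‖) ^ M * ‖φ y‖ ≤ 2 ^ M * S := fun y => by
    have := SchwartzMap.one_add_le_sup_seminorm_apply (𝕜 := ℂ) (m := (M, M)) (k := M) (n := 0)
      le_rfl (Nat.zero_le _) φ y
    rw [norm_iteratedFDeriv_zero] at this
    exact this
  refine (lqNorm_le_tsum hq _).trans ?_
  have hterm : ∀ i, ENNReal.ofReal (weight x i ^ s) *
      eLpNorm (fun y => (ψ i y : ℂ) * φ y) p volume ≤
      ENNReal.ofReal (2 ^ M * C ^ M * (1 + K) * S) *
        ENNReal.ofReal (weight x i ^ (-((d : ℝ) + 1))) := fun i => by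
    have hw := weight_pos x i
    set w := weight x i with hwdef
    set B : ℝ := 2 ^ M * S * C ^ M * w ^ (-(M : ℝ)) with hB
    have hB0 : 0 ≤ B := by positivity
    have h1 : ∀ y, ‖(ψ i y : ℂ) * φ y‖ₑ ≤ ‖(U i).indicator (fun _ => (B : ℂ)) y‖ₑ := fun y => by
      by_cases hy : y ∈ U i
      · rw [indicator_of_mem hy, enorm_mul]
        refine (mul_le_of_le_one_left' (hψ.enorm_le_one i y)).trans ?_
        rw [← ofReal_norm, ← ofReal_norm, Complex.norm_real, Real.norm_of_nonneg hB0]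
        refine ENNReal.ofReal_le_ofReal ?_
        rw [hB, Real.rpow_neg hw.le, Real.rpow_natCast, ← div_eq_mul_inv,
          le_div_iff₀ (by positivity)]
        calc ‖φ y‖ * w ^ M ≤ ‖φ y‖ * (C * (1 + ‖y‖)) ^ M := by
              gcongr
              exact (hb i y hy).1
          _ = (1 + ‖y‖) ^ M * ‖φ y‖ * C ^ M := by rw [mul_pow]; ring
          _ ≤ 2 ^ M * S * C ^ M := mul_le_mul_of_nonneg_right (hdecay y) (by positivity)
      · simp [hψ.eq_zero_of_notMem hy]
    have h2 : eLpNorm (fun y => (ψ i y : ℂ) * φ y) p volume ≤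
        ENNReal.ofReal (B * ((1 + K) * w ^ (d : ℝ))) := by
      refine (eLpNorm_mono_enorm h1).trans ((eLpNorm_indicator_const_le _ _).trans ?_)
      rw [ENNReal.ofReal_mul hB0, ← ofReal_norm, Complex.norm_real, Real.norm_of_nonneg hB0]
      gcongr
      have hθ : 1 / p.toReal ≤ 1 := by
        by_cases hpt : p = ⊤
        · simp [hpt]
        · exact div_le_one_of_le₀ (one_le_toReal hp hpt) ENNReal.toReal_nonneg
      refine (rpow_le_one_add _ (by positivity) hθ).trans ?_
      refine (add_le_add_right (hvol i) 1).trans ?_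
      rw [← ENNReal.ofReal_one, ← ENNReal.ofReal_add zero_le_one (by positivity)]
      refine ENNReal.ofReal_le_ofReal ?_
      have : 1 ≤ w ^ (d : ℝ) := Real.one_le_rpow (one_le_weight x i) (Nat.cast_nonneg d)
      linarith
    refine (mul_le_mul_right h2 _).trans ?_
    rw [← ENNReal.ofReal_mul (by positivity), ← ENNReal.ofReal_mul (by positivity)]
    refine ENNReal.ofReal_le_ofReal ?_
    have h3 : w ^ s * w ^ (-(M : ℝ)) * w ^ (d : ℝ) ≤ w ^ (-((d : ℝ) + 1)) := by
      rw [← Real.rpow_add hw, ← Real.rpow_add hw]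
      exact Real.rpow_le_rpow_of_exponent_le (one_le_weight x i) (by linarith)
    calc w ^ s * (B * ((1 + K) * w ^ (d : ℝ)))
        = 2 ^ M * C ^ M * (1 + K) * S * (w ^ s * w ^ (-(M : ℝ)) * w ^ (d : ℝ)) := by
          rw [hB]; ring
      _ ≤ _ := by gcongr
  refine (ENNReal.tsum_le_tsum hterm).trans ?_
  rw [ENNReal.tsum_mul_left, ← hS₀]
  nth_rewrite 1 [← ENNReal.ofReal_toReal hsum]
  rw [← ENNReal.ofReal_mul (by positivity)]
  refine ENNReal.ofReal_le_ofReal (le_of_eq ?_)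
  ring

end Partition

/-! ### Pairing and gluing of functions -/

section Functions

variable {d : ℕ} {ι : Type*} {U : ι → Set (Euc d)} {x : ι → Euc d}
  {ψ : ι → Euc d → ℝ}

theorem IsBAPU.tsum_enorm_eq_one (h : IsBAPU U ψ) (y : Euc d) :
    ∑' i, ‖(ψ i y : ℂ)‖ₑ = 1 := by
  have h1 : ∀ i, ‖(ψ i y : ℂ)‖ₑ = ENNReal.ofReal (ψ i y) := fun i => by
    rw [← ofReal_norm, Complex.norm_real, Real.norm_of_nonneg (h.nonneg i y)]
  simp_rw [h1]
  rw [← ENNReal.ofReal_tsum_of_nonneg (fun i => h.nonneg i y) (h.sum_eq_one y).summable,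
    (h.sum_eq_one y).tsum_eq, ENNReal.ofReal_one]

theorem IsBAPU.ae_eq_of_forall_mul [Countable ι] (h : IsBAPU U ψ) {F G : Euc d → ℂ}
    (hFG : ∀ i, (fun y => (ψ i y : ℂ) * F y) =ᵐ[volume] fun y => (ψ i y : ℂ) * G y) :
    F =ᵐ[volume] G := by
  filter_upwards [ae_all_iff.2 hFG] with y hy
  have : ∃ i, ψ i y ≠ 0 := by
    by_contra! h0
    have h1 := h.sum_eq_one y
    simp only [h0] at h1
    exact zero_ne_one (hasSum_zero.unique h1)
  obtain ⟨i, hi⟩ := this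
  exact mul_left_cancel₀ (by exact_mod_cast hi) (hy i)

/-- On a member of the covering a function is the sum of its localisations to the neighbours. -/
theorem eLpNorm_indicator_le_sum_neighbours (hψ : IsBAPU U ψ) {N : ι → Finset ι}
    (hN : ∀ i j, j ∈ N i ↔ (U j ∩ U i).Nonempty) {p : ℝ≥0∞} (hp : 1 ≤ p) {H : Euc d → ℂ}
    (hH : AEStronglyMeasurable H volume) (i : ι) :
    eLpNorm ((U i).indicator H) p volume ≤
      ∑ j ∈ N i, eLpNorm (fun y => (ψ j y : ℂ) * H y) p volume := by
  refine le_trans (eLpNorm_mono_enorm (g := ∑ j ∈ N i, fun y => (ψ j y : ℂ) * H y) fun y => ?_)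
    (eLpNorm_sum_le (fun j _ => (hψ.continuous j).aestronglyMeasurable.mul hH) hp)
  by_cases hy : y ∈ U i
  · rw [indicator_of_mem hy, Finset.sum_apply, ← Finset.sum_mul,
      hψ.sum_eq_one_of_subset fun j hj => (hN i j).2 ⟨y, hj, hy⟩, one_mul]
  · simp [hy]

/-- Hölder's inequality for the decomposition norms. -/
theorem exists_lintegral_mul_le [Countable ι] (hU : IsWeightedCovering U x) (hψ : IsBAPU U ψ)
    (s : ℝ) {p q p' q' : ℝ≥0∞} (hp : p.HolderConjugate p') (hq : q.HolderConjugate q') :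
    ∃ C : ℝ, 0 ≤ C ∧ ∀ F H : Euc d → ℂ, AEStronglyMeasurable F volume →
      AEStronglyMeasurable H volume → ∫⁻ y, ‖F y * H y‖ₑ ≤
        ENNReal.ofReal C * funNorm p q x ψ s F * funNorm p' q' x ψ (-s) H := by
  obtain ⟨N, n₀, hcard, hN⟩ := hU.admissible.exists_neighbours
  obtain ⟨C, hC, hw⟩ := hU.exists_weight_rpow_le (-s)
  have hsymm : ∀ i j, j ∈ N i ↔ i ∈ N j := fun i j => by rw [hN, hN, inter_comm]
  refine ⟨C * n₀, by positivity, fun F H hF hH => ?_⟩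
  set a : ι → ℝ≥0∞ := fun i => ENNReal.ofReal (weight x i ^ s) *
    eLpNorm (fun y => (ψ i y : ℂ) * F y) p volume with ha
  set b : ι → ℝ≥0∞ := fun i => ENNReal.ofReal (weight x i ^ (-s)) *
    eLpNorm (fun y => (ψ i y : ℂ) * H y) p' volume with hb
  have hpoint : ∀ y, ‖F y * H y‖ₑ = ∑' i, ‖((ψ i y : ℂ) * F y) * (U i).indicator H y‖ₑ := by
    intro y
    have h1 : ∀ i, ‖((ψ i y : ℂ) * F y) * (U i).indicator H y‖ₑ =
        ‖(ψ i y : ℂ)‖ₑ * ‖F y * H y‖ₑ := fun i => by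
      by_cases hy : y ∈ U i
      · rw [indicator_of_mem hy, mul_assoc, enorm_mul]
      · simp [hψ.eq_zero_of_notMem hy]
    simp_rw [h1]
    rw [ENNReal.tsum_mul_right, hψ.tsum_enorm_eq_one, one_mul]
  have hmeasF : ∀ i, AEStronglyMeasurable (fun y => (ψ i y : ℂ) * F y) volume := fun i =>
    (hψ.continuous i).aestronglyMeasurable.mul hF
  have hmeasH : ∀ i, AEStronglyMeasurable ((U i).indicator H) volume := fun i =>
    hH.indicator (hU.isOpen i).measurableSet
  have hterm : ∀ i, ∫⁻ y, ‖((ψ i y : ℂ) * F y) * (U i).indicator H y‖ₑ ≤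
      a i * (ENNReal.ofReal C * ∑ j ∈ N i, b j) := fun i => by
    have h1 := eLpNorm_smul_le_mul_eLpNorm (r := 1) (p := p) (q := p') (hmeasH i) (hmeasF i)
    rw [eLpNorm_one_eq_lintegral_enorm] at h1
    refine h1.trans ((mul_le_mul_right
      (eLpNorm_indicator_le_sum_neighbours hψ hN hp.symm.one_le hH i) _).trans ?_)
    have h2 : (1 : ℝ≥0∞) =
        ENNReal.ofReal (weight x i ^ s) * ENNReal.ofReal (weight x i ^ (-s)) := by
      rw [← ENNReal.ofReal_mul (Real.rpow_nonneg (weight_pos x i).le _),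
        ← Real.rpow_add (weight_pos x i)]
      simp
    calc eLpNorm (fun y => (ψ i y : ℂ) * F y) p volume *
          ∑ j ∈ N i, eLpNorm (fun y => (ψ j y : ℂ) * H y) p' volume
        = a i * ∑ j ∈ N i, ENNReal.ofReal (weight x i ^ (-s)) *
            eLpNorm (fun y => (ψ j y : ℂ) * H y) p' volume := by
          rw [← Finset.mul_sum, ha]
          nth_rewrite 1 [← one_mul (eLpNorm (fun y => (ψ i y : ℂ) * F y) p volume)]
          rw [h2]
          ring
      _ ≤ a i * (ENNReal.ofReal C * ∑ j ∈ N i, b j) := by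
          rw [Finset.mul_sum (N i) b]
          refine mul_le_mul_right (Finset.sum_le_sum fun j hj => ?_) _
          rw [hb, ← mul_assoc, ← ENNReal.ofReal_mul hC]
          gcongr
          exact hw i j ((hN i j).1 hj)
  calc ∫⁻ y, ‖F y * H y‖ₑ
      = ∑' i, ∫⁻ y, ‖((ψ i y : ℂ) * F y) * (U i).indicator H y‖ₑ :=
        (lintegral_congr hpoint).trans
          (lintegral_tsum fun i => ((hmeasF i).mul (hmeasH i)).enorm)
    _ ≤ ∑' i, a i * (ENNReal.ofReal C * ∑ j ∈ N i, b j) := ENNReal.tsum_le_tsum hterm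
    _ ≤ lqNorm q a * lqNorm q' (fun i => ENNReal.ofReal C * ∑ j ∈ N i, b j) :=
        tsum_mul_le_lqNorm_mul_lqNorm hq _ _
    _ ≤ lqNorm q a * (ENNReal.ofReal C * (n₀ * lqNorm q' b)) := by
        rw [lqNorm_const_mul hq.symm.one_le]
        gcongr
        exact lqNorm_sum_neighbours_le hq.symm.one_le hcard hsymm b
    _ = ENNReal.ofReal (C * n₀) * lqNorm q a * lqNorm q' b := by
        rw [ENNReal.ofReal_mul hC, ENNReal.ofReal_natCast]
        ring

/-- A function of finite decomposition norm is integrable against Schwartz functions, with a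
bound by one Schwartz seminorm. -/
theorem exists_lintegral_schwartz_mul_le [Countable ι] (hU : IsWeightedCovering U x)
    (hψ : IsBAPU U ψ) (s : ℝ) {p q : ℝ≥0∞} (hp : 1 ≤ p) (hq : 1 ≤ q) :
    ∃ (C : ℝ) (M : ℕ), 0 ≤ C ∧ ∀ F : Euc d → ℂ, AEStronglyMeasurable F volume →
      ∀ φ : 𝓢(Euc d, ℂ), ∫⁻ y, ‖φ y * F y‖ₑ ≤ funNorm p q x ψ s F * ENNReal.ofReal
        (C * (Finset.Iic (M, M)).sup (schwartzSeminormFamily ℂ (Euc d) ℂ) φ) := by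
  have hp' := ENNReal.HolderConjugate.inv_one_sub_inv' hp
  have hq' := ENNReal.HolderConjugate.inv_one_sub_inv' hq
  obtain ⟨C, hC, hpair⟩ := exists_lintegral_mul_le hU hψ s hp' hq'
  obtain ⟨C', M, hC', hS⟩ := exists_funNorm_schwartz_le hU hψ (-s) hp'.symm.one_le hq'.symm.one_le
  refine ⟨C * C', M, by positivity, fun F hF φ => ?_⟩
  simp_rw [mul_comm (φ _)]
  refine (hpair F φ hF φ.continuous.aestronglyMeasurable).trans ?_
  refine (mul_le_mul_right (hS φ) _).trans (le_of_eq ?_)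
  rw [mul_assoc C, ENNReal.ofReal_mul hC]
  ring

/-- Local pieces `g_i` that are compatible in the sense that `ψ_j g_i = ψ_i g_j` are the
localisations `ψ_i F` of one function `F`. -/
theorem exists_glue [Countable ι] (hU : IsWeightedCovering U x) (hψ : IsBAPU U ψ)
    {g : ι → Euc d → ℂ} (hg : ∀ i, AEStronglyMeasurable (g i) volume)
    (hcomp : ∀ i j, (fun y => (ψ j y : ℂ) * g i y) =ᵐ[volume] fun y => (ψ i y : ℂ) * g j y) :
    ∃ F : Euc d → ℂ, AEStronglyMeasurable F volume ∧
      ∀ i, (fun y => (ψ i y : ℂ) * F y) =ᵐ[volume] g i := by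
  classical
  obtain ⟨N, n₀, hcard, hN⟩ := hU.admissible.exists_neighbours
  have hall : ∀ᵐ y, ∀ i j, (ψ j y : ℂ) * g i y = (ψ i y : ℂ) * g j y :=
    ae_all_iff.2 fun i => ae_all_iff.2 fun j => hcomp i j
  have hmain : ∀ᵐ y, HasSum (fun i => g i y) (∑' i, g i y) ∧
      ∀ i, (ψ i y : ℂ) * ∑' i, g i y = g i y := by
    filter_upwards [hall] with y hy
    obtain ⟨k, hk⟩ := hU.admissible.exists_mem y
    have h1 : ∑ j ∈ N k, (ψ j y : ℂ) = 1 :=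
      hψ.sum_eq_one_of_subset fun j hj => (hN k j).2 ⟨y, hj, hk⟩
    have h2 : ∀ i, g i y = ψ i y * ∑ j ∈ N k, g j y := fun i => by
      rw [Finset.mul_sum, ← Finset.sum_congr rfl fun j _ => hy i j, ← Finset.sum_mul, h1, one_mul]
    have h3 : HasSum (fun i => g i y) (∑ i ∈ N k, g i y) :=
      hasSum_sum_of_ne_finset_zero fun i hi => by
        rw [h2 i, hψ.eq_zero_of_notMem fun hyi => hi ((hN k i).2 ⟨y, hyi, hk⟩)]
        simp
    rw [h3.tsum_eq]
    exact ⟨h3, fun i => (h2 i).symm⟩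
  refine ⟨fun y => ∑' i, g i y, ?_, fun i => ?_⟩
  · refine aestronglyMeasurable_of_tendsto_ae (atTop : Filter (Finset ι))
      (f := fun I y => ∑ i ∈ I, g i y) (fun I => ?_) ?_
    · exact Finset.aestronglyMeasurable_fun_sum I fun i _ => hg i
    · filter_upwards [hmain] with y hy using hy.1
  · filter_upwards [hmain] with y hy using hy.2 i

end Functions

/-! ### Densities of tempered distributions -/

section Density

variable {d : ℕ} {ι : Type*} {U : ι → Set (Euc d)} {x : ι → Euc d} {ψ : ι → Euc d → ℝ}
  {p q : ℝ≥0∞} {s : ℝ}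

/-- The function `F` is the density of the tempered distribution `f` as far as the localisations
by the `ψ_i` are concerned: each `ψ_i F` is in `L^p` and represents `ψ_i f`. -/
structure IsDensity (p : ℝ≥0∞) (ψ : ι → Euc d → ℝ) (f : 𝓢'(Euc d, ℂ)) (F : Euc d → ℂ) : Prop where
  aestronglyMeasurable : AEStronglyMeasurable F volume
  memLp : ∀ i, MemLp (fun y => (ψ i y : ℂ) * F y) p volume
  cutoff_apply : ∀ i (φ : 𝓢(Euc d, ℂ)), cutoff (ψ i) f φ = ∫ y, φ y * ((ψ i y : ℂ) * F y)

theorem distribution_map_sum (f : 𝓢'(Euc d, ℂ)) (I : Finset ι) (φ : ι → 𝓢(Euc d, ℂ)) :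
    f (∑ i ∈ I, φ i) = ∑ i ∈ I, f (φ i) :=
  map_sum (show 𝓢(Euc d, ℂ) →L[ℂ] ℂ from f) φ I

theorem lp_toTemperedDistribution_injective [Fact (1 ≤ p)]
    {g h : Lp ℂ p (volume : Measure (Euc d))}
    (hgh : Lp.toTemperedDistribution g = Lp.toTemperedDistribution h) : g = h := by
  have h1 := Lp.ker_toTemperedDistributionCLM_eq_bot (F := ℂ) (μ := (volume : Measure (Euc d)))
    (p := p)
  exact LinearMap.ker_eq_bot.1 h1 hgh

theorem toTemperedDistribution_toLp_apply [Fact (1 ≤ p)] {g : Euc d → ℂ} (hg : MemLp g p volume)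
    (φ : 𝓢(Euc d, ℂ)) : Lp.toTemperedDistribution (hg.toLp g) φ = ∫ y, φ y * g y := by
  rw [Lp.toTemperedDistribution_apply]
  refine integral_congr_ae ?_
  filter_upwards [hg.coeFn_toLp] with y hy
  rw [hy, smul_eq_mul]

theorem distLpNorm_toTemperedDistribution [Fact (1 ≤ p)]
    (g : Lp ℂ p (volume : Measure (Euc d))) :
    distLpNorm p (Lp.toTemperedDistribution g) = ‖g‖ₑ := by
  refine le_antisymm (distLpNorm_le p g rfl) (le_iInf₂ fun h hh => ?_)
  rw [lp_toTemperedDistribution_injective hh]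

theorem exists_toTemperedDistribution_eq [Fact (1 ≤ p)] {u : 𝓢'(Euc d, ℂ)}
    (hu : distLpNorm p u < ⊤) :
    ∃ g : Lp ℂ p (volume : Measure (Euc d)), Lp.toTemperedDistribution g = u := by
  by_contra! h
  simp [distLpNorm, h] at hu

theorem cutoff_apply_eq (ψ : ι → Euc d → ℝ) (i : ι) (f : 𝓢'(Euc d, ℂ)) (φ : 𝓢(Euc d, ℂ)) :
    cutoff (ψ i) f φ = f (SchwartzMap.smulLeftCLM ℂ (fun y => (ψ i y : ℂ)) φ) := rfl

theorem IsBAPU.smulLeftCLM_apply (hψ : IsBAPU U ψ) (i : ι) (φ : 𝓢(Euc d, ℂ)) (y : Euc d) :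
    SchwartzMap.smulLeftCLM ℂ (fun y => (ψ i y : ℂ)) φ y = ψ i y * φ y := by
  rw [SchwartzMap.smulLeftCLM_apply_apply (hψ.hasTemperateGrowth i), smul_eq_mul]

theorem IsDensity.cutoff_eq [Fact (1 ≤ p)] {f : 𝓢'(Euc d, ℂ)} {F : Euc d → ℂ}
    (h : IsDensity p ψ f F) (i : ι) :
    Lp.toTemperedDistribution ((h.memLp i).toLp _) = cutoff (ψ i) f := by
  ext φ
  rw [toTemperedDistribution_toLp_apply, h.cutoff_apply]

theorem IsDensity.decompNorm_eq [Fact (1 ≤ p)] [Fact (1 ≤ q)] {f : 𝓢'(Euc d, ℂ)}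
    {F : Euc d → ℂ} (h : IsDensity p ψ f F) :
    decompNorm p q x ψ s f = funNorm p q x ψ s F := by
  unfold decompNorm funNorm
  congr 1
  ext i
  rw [← h.cutoff_eq i, distLpNorm_toTemperedDistribution, Lp.enorm_toLp]

theorem ofReal_weight_rpow_ne_zero (x : ι → Euc d) (s : ℝ) (i : ι) :
    ENNReal.ofReal (weight x i ^ s) ≠ 0 := by
  rw [Ne, ENNReal.ofReal_eq_zero, not_le]
  exact Real.rpow_pos_of_pos (weight_pos x i) s

theorem distLpNorm_cutoff_lt_top [Fact (1 ≤ p)] [Fact (1 ≤ q)] {f : 𝓢'(Euc d, ℂ)}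
    (hf : decompNorm p q x ψ s f < ⊤) (i : ι) : distLpNorm p (cutoff (ψ i) f) < ⊤ := by
  have h1 := (le_lqNorm (Fact.out : 1 ≤ q) (fun i => ENNReal.ofReal (weight x i ^ s) *
    distLpNorm p (cutoff (ψ i) f)) i).trans_lt hf
  exact ENNReal.lt_top_of_mul_ne_top_right h1.ne (ofReal_weight_rpow_ne_zero x s i)

theorem memLp_of_funNorm_lt_top (hψ : IsBAPU U ψ) (hq : 1 ≤ q) {F : Euc d → ℂ}
    (hF : AEStronglyMeasurable F volume) (h : funNorm p q x ψ s F < ⊤) (i : ι) :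
    MemLp (fun y => (ψ i y : ℂ) * F y) p volume := by
  refine ⟨(hψ.continuous i).aestronglyMeasurable.mul hF, ?_⟩
  have h1 := (le_lqNorm hq (fun i => ENNReal.ofReal (weight x i ^ s) *
    eLpNorm (fun y => (ψ i y : ℂ) * F y) p volume) i).trans_lt h
  exact ENNReal.lt_top_of_mul_ne_top_right h1.ne (ofReal_weight_rpow_ne_zero x s i)

theorem memLp_partition_mul (hψ : IsBAPU U ψ) {g : Euc d → ℂ} (hg : MemLp g p volume) (i : ι) :
    MemLp (fun y => (ψ i y : ℂ) * g y) p volume :=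
  ⟨(hψ.continuous i).aestronglyMeasurable.mul hg.1, (hψ.eLpNorm_mul_le i g p).trans_lt hg.2⟩

/-- A distribution of finite decomposition norm has a density, glued from the functions that
represent its localisations. -/
theorem exists_isDensity [Countable ι] [Fact (1 ≤ p)] [Fact (1 ≤ q)]
    (hU : IsWeightedCovering U x) (hψ : IsBAPU U ψ)
    {f : 𝓢'(Euc d, ℂ)} (hf : decompNorm p q x ψ s f < ⊤) : ∃ F, IsDensity p ψ f F := by
  choose g hg using fun i => exists_toTemperedDistribution_eq (distLpNorm_cutoff_lt_top hf i)
  have hgφ : ∀ i (φ : 𝓢(Euc d, ℂ)), cutoff (ψ i) f φ = ∫ y, φ y * g i y := fun i φ => by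
    rw [← hg i, Lp.toTemperedDistribution_apply]
    rfl
  have hmem : ∀ i j, MemLp (fun y => (ψ j y : ℂ) * g i y) p volume := fun i j =>
    memLp_partition_mul hψ (Lp.memLp (g i)) j
  have hcomp : ∀ i j, (fun y => (ψ j y : ℂ) * g i y) =ᵐ[volume] fun y => (ψ i y : ℂ) * g j y := by
    intro i j
    rw [← MemLp.toLp_eq_toLp_iff (hmem i j) (hmem j i)]
    refine lp_toTemperedDistribution_injective ?_
    -- both sides represent the distribution `ψ_i ψ_j f`
    have key : ∀ i j (φ : 𝓢(Euc d, ℂ)), ∫ y, φ y * ((ψ j y : ℂ) * g i y) =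
        f (SchwartzMap.smulLeftCLM ℂ (fun y => (ψ i y : ℂ))
          (SchwartzMap.smulLeftCLM ℂ (fun y => (ψ j y : ℂ)) φ)) := fun i j φ => by
      rw [← cutoff_apply_eq ψ i, hgφ]
      congr 1
      ext y
      rw [hψ.smulLeftCLM_apply]
      ring
    ext φ
    rw [toTemperedDistribution_toLp_apply, toTemperedDistribution_toLp_apply, key, key]
    congr 1
    ext y
    simp only [hψ.smulLeftCLM_apply]
    ring
  obtain ⟨F, hF, hFg⟩ := exists_glue hU hψ (fun i => (Lp.memLp (g i)).1) hcomp
  refine ⟨F, hF, fun i => (memLp_congr_ae (hFg i)).2 (Lp.memLp (g i)), fun i φ => ?_⟩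
  rw [hgφ]
  refine integral_congr_ae ?_
  filter_upwards [hFg i] with y hy
  rw [hy]

theorem IsDensity.ae_eq [Countable ι] [Fact (1 ≤ p)] (hψ : IsBAPU U ψ) {f : 𝓢'(Euc d, ℂ)}
    {F G : Euc d → ℂ} (hF : IsDensity p ψ f F) (hG : IsDensity p ψ f G) : F =ᵐ[volume] G := by
  refine hψ.ae_eq_of_forall_mul fun i => ?_
  rw [← MemLp.toLp_eq_toLp_iff (hF.memLp i) (hG.memLp i)]
  exact lp_toTemperedDistribution_injective ((hF.cutoff_eq i).trans (hG.cutoff_eq i).symm)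

theorem integral_schwartz_add {F G : Euc d → ℂ} {φ : Euc d → ℂ}
    (hF : Integrable (fun y => φ y * F y)) (hG : Integrable (fun y => φ y * G y)) :
    ∫ y, φ y * (F y + G y) = (∫ y, φ y * F y) + ∫ y, φ y * G y := by
  rw [← integral_add hF hG]
  simp_rw [mul_add]

theorem integrable_schwartz_mul_memLp [Fact (1 ≤ p)] {g : Euc d → ℂ} (hg : MemLp g p volume)
    (φ : 𝓢(Euc d, ℂ)) : Integrable (fun y => φ y * g y) := by
  have := ENNReal.HolderConjugate.inv_one_sub_inv' (Fact.out : 1 ≤ p)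
  exact memLp_one_iff_integrable.1 (hg.mul (φ.memLp (1 - p⁻¹)⁻¹ volume))

theorem IsDensity.add [Fact (1 ≤ p)] {f g : 𝓢'(Euc d, ℂ)} {F G : Euc d → ℂ}
    (hF : IsDensity p ψ f F) (hG : IsDensity p ψ g G) :
    IsDensity p ψ (f + g) (fun y => F y + G y) where
  aestronglyMeasurable := hF.1.add hG.1
  memLp i := by
    simp_rw [mul_add]
    exact (hF.memLp i).add (hG.memLp i)
  cutoff_apply i φ := by
    simp_rw [mul_add (ψ i _ : ℂ)]
    rw [map_add, integral_schwartz_add (integrable_schwartz_mul_memLp (hF.memLp i) φ)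
      (integrable_schwartz_mul_memLp (hG.memLp i) φ), ← hF.cutoff_apply, ← hG.cutoff_apply]
    rfl

theorem IsDensity.smul {f : 𝓢'(Euc d, ℂ)} {F : Euc d → ℂ} (hF : IsDensity p ψ f F) (c : ℂ) :
    IsDensity p ψ (c • f) (fun y => c * F y) where
  aestronglyMeasurable := hF.1.const_mul c
  memLp i := by
    simp_rw [mul_left_comm _ c]
    exact (hF.memLp i).const_mul c
  cutoff_apply i φ := by
    simp_rw [mul_left_comm _ c]
    rw [map_smul, integral_const_mul, ← hF.cutoff_apply]
    rfl

theorem IsDensity.sub [Fact (1 ≤ p)] {f g : 𝓢'(Euc d, ℂ)} {F G : Euc d → ℂ}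
    (hF : IsDensity p ψ f F) (hG : IsDensity p ψ g G) :
    IsDensity p ψ (f - g) (fun y => F y - G y) := by
  have h1 := hF.add (hG.smul (-1))
  simp only [neg_one_mul, ← sub_eq_add_neg] at h1
  have h2 : f - g = f + (-1 : ℂ) • g := by
    rw [sub_eq_add_neg, neg_one_smul ℂ g]
  rwa [h2]

/-- Distributions given by integration against `F`. -/
theorem IsDensity.of_forall_apply (hψ : IsBAPU U ψ) (hq : 1 ≤ q) {f : 𝓢'(Euc d, ℂ)}
    {F : Euc d → ℂ} (hF : AEStronglyMeasurable F volume) (hN : funNorm p q x ψ s F < ⊤)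
    (hf : ∀ φ : 𝓢(Euc d, ℂ), f φ = ∫ y, φ y * F y) : IsDensity p ψ f F where
  aestronglyMeasurable := hF
  memLp := memLp_of_funNorm_lt_top hψ hq hF hN
  cutoff_apply i φ := by
    rw [cutoff_apply_eq, hf]
    congr 1
    ext y
    rw [hψ.smulLeftCLM_apply]
    ring

theorem integrable_schwartz_mul [Countable ι] (hU : IsWeightedCovering U x) (hψ : IsBAPU U ψ)
    (hp : 1 ≤ p) (hq : 1 ≤ q) {F : Euc d → ℂ} (hF : AEStronglyMeasurable F volume)
    (hN : funNorm p q x ψ s F < ⊤) (φ : 𝓢(Euc d, ℂ)) : Integrable (fun y => φ y * F y) := by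
  obtain ⟨C, M, hC, hle⟩ := exists_lintegral_schwartz_mul_le hU hψ s hp hq
  exact ⟨φ.continuous.aestronglyMeasurable.mul hF,
    (hle F hF φ).trans_lt (ENNReal.mul_lt_top hN ENNReal.ofReal_lt_top)⟩

theorem norm_integral_schwartz_mul_le [Countable ι] (hU : IsWeightedCovering U x)
    (hψ : IsBAPU U ψ) (s : ℝ) (hp : 1 ≤ p) (hq : 1 ≤ q) :
    ∃ (C : ℝ) (M : ℕ), 0 ≤ C ∧ ∀ F : Euc d → ℂ, AEStronglyMeasurable F volume →
      funNorm p q x ψ s F < ⊤ → ∀ φ : 𝓢(Euc d, ℂ), ‖∫ y, φ y * F y‖ ≤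
        C * (funNorm p q x ψ s F).toReal *
          (Finset.Iic (M, M)).sup (schwartzSeminormFamily ℂ (Euc d) ℂ) φ := by
  obtain ⟨C, M, hC, hle⟩ := exists_lintegral_schwartz_mul_le hU hψ s hp hq
  refine ⟨C, M, hC, fun F hF hN φ => ?_⟩
  have h1 := (enorm_integral_le_lintegral_enorm (μ := volume) fun y => φ y * F y).trans (hle F hF φ)
  have h2 := ENNReal.toReal_mono (ENNReal.mul_lt_top hN ENNReal.ofReal_lt_top).ne h1
  rw [toReal_enorm, ENNReal.toReal_mul, ENNReal.toReal_ofReal (by positivity)] at h2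
  refine h2.trans (le_of_eq ?_)
  ring

/-- A function of finite decomposition norm defines a tempered distribution. -/
theorem exists_distribution [Countable ι] (hU : IsWeightedCovering U x) (hψ : IsBAPU U ψ)
    (hp : 1 ≤ p) (hq : 1 ≤ q) {F : Euc d → ℂ} (hF : AEStronglyMeasurable F volume)
    (hN : funNorm p q x ψ s F < ⊤) :
    ∃ f : 𝓢'(Euc d, ℂ), ∀ φ : 𝓢(Euc d, ℂ), f φ = ∫ y, φ y * F y := by
  obtain ⟨C, M, hC, hle⟩ := norm_integral_schwartz_mul_le hU hψ s hp hq
  let L : 𝓢(Euc d, ℂ) →L[ℂ] ℂ := SchwartzMap.mkCLMtoNormedSpace (fun φ => ∫ y, φ y * F y)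
    (fun φ χ => by
      rw [← integral_add (integrable_schwartz_mul hU hψ hp hq hF hN φ)
        (integrable_schwartz_mul hU hψ hp hq hF hN χ)]
      simp [add_mul])
    (fun c φ => by
      simp [mul_assoc, integral_const_mul])
    ⟨Finset.Iic (M, M), C * (funNorm p q x ψ s F).toReal, by positivity, hle F hF hN⟩
  exact ⟨ContinuousLinearMap.toPointwiseConvergenceCLM _ _ _ _ L, fun φ => rfl⟩

/-- The density represents the distribution on all Schwartz functions. On compactly supported
ones the sum over the partition is finite; the general case follows by density, because
`∑ ψ_i φ` need not converge in the Schwartz space. -/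
theorem IsDensity.apply_eq_integral [Countable ι] [Fact (1 ≤ p)] [Fact (1 ≤ q)]
    (hU : IsWeightedCovering U x) (hψ : IsBAPU U ψ) {f : 𝓢'(Euc d, ℂ)} {F : Euc d → ℂ}
    (h : IsDensity p ψ f F) (hN : funNorm p q x ψ s F < ⊤) (φ : 𝓢(Euc d, ℂ)) :
    f φ = ∫ y, φ y * F y := by
  classical
  obtain ⟨f', hf'⟩ := exists_distribution hU hψ (Fact.out : 1 ≤ p) (Fact.out : 1 ≤ q) h.1 hN
  rw [← hf']
  refine schwartz_functional_ext (f := fun φ => f φ) (g := fun φ => f' φ)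
    (ContinuousLinearMap.continuous f) (ContinuousLinearMap.continuous f') (fun φ hφ => ?_) φ
  obtain ⟨N, n₀, -, hNb⟩ := hU.admissible.exists_neighbours
  obtain ⟨J, hJ⟩ := hφ.isCompact.elim_finite_subcover U hU.isOpen
    (by rw [hU.admissible.iUnion_eq]; exact subset_univ _)
  set I := J.biUnion N with hI
  have hsum : φ = ∑ i ∈ I, SchwartzMap.smulLeftCLM ℂ (fun y => (ψ i y : ℂ)) φ := by
    ext y
    rw [sum_apply]
    simp_rw [hψ.smulLeftCLM_apply]
    by_cases hy : φ y = 0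
    · simp [hy]
    · obtain ⟨j, hjJ, hyj⟩ := mem_iUnion₂.1 (hJ (subset_tsupport _ hy))
      rw [← Finset.sum_mul, hψ.sum_eq_one_of_subset, one_mul]
      exact fun i hi => Finset.mem_biUnion.2 ⟨j, hjJ, (hNb j i).2 ⟨y, hi, hyj⟩⟩
  rw [hsum, distribution_map_sum, distribution_map_sum]
  refine Finset.sum_congr rfl fun i _ => ?_
  rw [← cutoff_apply_eq ψ i f, h.cutoff_apply, hf']
  congr 1
  ext y
  rw [hψ.smulLeftCLM_apply]
  ring

/-- The density of a Schwartz function is the function itself. -/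
theorem isDensity_schwartz [Countable ι] (hU : IsWeightedCovering U x) (hψ : IsBAPU U ψ)
    (hp : 1 ≤ p) (φ : 𝓢(Euc d, ℂ)) : IsDensity p ψ (φ : 𝓢'(Euc d, ℂ)) φ := by
  obtain ⟨C, M, -, hle⟩ := exists_funNorm_schwartz_le hU hψ 0 hp le_rfl
  refine IsDensity.of_forall_apply (x := x) (s := 0) (q := 1) hψ le_rfl
    φ.continuous.aestronglyMeasurable ((hle φ).trans_lt ENNReal.ofReal_lt_top) fun χ => ?_
  rw [SchwartzMap.coe_apply]
  rfl

end Density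

/-! ### The decomposition space as a space of functions -/

namespace DecompSpace

variable {d : ℕ} {ι : Type*} {U : ι → Set (Euc d)} {x : ι → Euc d}
  {ψ : ι → Euc d → ℝ} {p q : ℝ≥0∞} [Fact (1 ≤ p)] [Fact (1 ≤ q)] {s : ℝ}

theorem ofReal_norm_eq (f : DecompSpace x ψ s p q) {F : Euc d → ℂ}
    (hF : IsDensity p ψ (toDistribution x ψ s p q f) F) :
    ENNReal.ofReal ‖f‖ = funNorm p q x ψ s F := by
  rw [norm_def, ENNReal.ofReal_toReal (decompNorm_lt_top x ψ s p q f).ne, hF.decompNorm_eq]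

theorem funNorm_lt_top (f : DecompSpace x ψ s p q) {F : Euc d → ℂ}
    (hF : IsDensity p ψ (toDistribution x ψ s p q f) F) : funNorm p q x ψ s F < ⊤ := by
  rw [← ofReal_norm_eq f hF]
  exact ENNReal.ofReal_lt_top

theorem exists_density [Countable ι] (hU : IsWeightedCovering U x) (hψ : IsBAPU U ψ)
    (f : DecompSpace x ψ s p q) : ∃ F, IsDensity p ψ (toDistribution x ψ s p q f) F :=
  exists_isDensity hU hψ (decompNorm_lt_top x ψ s p q f)

theorem exists_of_isDensity {f : 𝓢'(Euc d, ℂ)} {F : Euc d → ℂ} (hF : IsDensity p ψ f F)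
    (hN : funNorm p q x ψ s F < ⊤) :
    ∃ g : DecompSpace x ψ s p q, toDistribution x ψ s p q g = f := by
  rw [← hF.decompNorm_eq] at hN
  exact ⟨⟨f, hN⟩, rfl⟩

/-- Every function of finite decomposition norm is the density of an element of the space. -/
theorem exists_of_funNorm_lt_top [Countable ι] (hU : IsWeightedCovering U x) (hψ : IsBAPU U ψ)
    {F : Euc d → ℂ} (hF : AEStronglyMeasurable F volume) (hN : funNorm p q x ψ s F < ⊤) :
    ∃ g : DecompSpace x ψ s p q, IsDensity p ψ (toDistribution x ψ s p q g) F := by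
  have hp : 1 ≤ p := Fact.out
  have hq : 1 ≤ q := Fact.out
  obtain ⟨f, hf⟩ := exists_distribution hU hψ hp hq hF hN
  have hd : IsDensity p ψ f F := IsDensity.of_forall_apply hψ hq hF hN hf
  obtain ⟨g, hg⟩ := exists_of_isDensity hd hN
  exact ⟨g, hg ▸ hd⟩

theorem toDistribution_injective : Injective (toDistribution x ψ s p q) :=
  Subtype.val_injective

theorem apply_eq_integral [Countable ι] (hU : IsWeightedCovering U x) (hψ : IsBAPU U ψ)
    (f : DecompSpace x ψ s p q) {F : Euc d → ℂ}
    (hF : IsDensity p ψ (toDistribution x ψ s p q f) F) (φ : 𝓢(Euc d, ℂ)) :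
    toDistribution x ψ s p q f φ = ∫ y, φ y * F y :=
  hF.apply_eq_integral hU hψ (funNorm_lt_top f hF) φ

/-- The action of an element of the space on test functions is bounded by one Schwartz seminorm. -/
theorem exists_norm_apply_le [Countable ι] (hU : IsWeightedCovering U x) (hψ : IsBAPU U ψ) :
    ∃ (C : ℝ) (N : ℕ), ∀ (f : DecompSpace x ψ s p q) (φ : 𝓢(Euc d, ℂ)),
      ‖toDistribution x ψ s p q f φ‖ ≤
        C * ‖f‖ * (Finset.Iic (N, N)).sup (schwartzSeminormFamily ℂ (Euc d) ℂ) φ := by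
  obtain ⟨C, N, -, h⟩ := norm_integral_schwartz_mul_le (p := p) (q := q) hU hψ s Fact.out Fact.out
  refine ⟨C, N, fun f φ => ?_⟩
  obtain ⟨F, hF⟩ := exists_density hU hψ f
  rw [apply_eq_integral hU hψ f hF]
  have h1 := h F hF.1 (funNorm_lt_top f hF) φ
  rwa [← ofReal_norm_eq f hF, ENNReal.toReal_ofReal (norm_nonneg _)] at h1

theorem eq_zero_of_norm_eq_zero [Countable ι] (hU : IsWeightedCovering U x) (hψ : IsBAPU U ψ)
    (f : DecompSpace x ψ s p q) (hf : ‖f‖ = 0) : f = 0 := by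
  obtain ⟨C, N, h⟩ := exists_norm_apply_le (x := x) (ψ := ψ) (s := s) (p := p) (q := q) hU hψ
  apply toDistribution_injective
  rw [map_zero]
  ext φ
  have := h f φ
  rw [hf, mul_zero, zero_mul] at this
  exact norm_le_zero_iff.1 this

theorem continuous_toDistribution [Countable ι] (hU : IsWeightedCovering U x) (hψ : IsBAPU U ψ) :
    Continuous (toDistribution x ψ s p q) := by
  obtain ⟨C, N, h⟩ := exists_norm_apply_le (x := x) (ψ := ψ) (s := s) (p := p) (q := q) hU hψ
  refine PointwiseConvergenceCLM.continuous_of_continuous_eval fun φ => ?_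
  let L : DecompSpace x ψ s p q →ₗ[ℂ] ℂ :=
    { toFun := fun f => toDistribution x ψ s p q f φ
      map_add' := fun f g => by rw [map_add]; rfl
      map_smul' := fun c f => by rw [map_smul]; rfl }
  exact AddMonoidHomClass.continuous_of_bound L
    (C * (Finset.Iic (N, N)).sup (schwartzSeminormFamily ℂ (Euc d) ℂ) φ)
    fun f => (h f φ).trans_eq (by ring)

/-- The Schwartz space embeds continuously in the decomposition space. -/
theorem exists_schwartz_embedding [Countable ι] (hU : IsWeightedCovering U x) (hψ : IsBAPU U ψ) :
    ∃ J : 𝓢(Euc d, ℂ) →L[ℂ] DecompSpace x ψ s p q, ∀ φ : 𝓢(Euc d, ℂ),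
      toDistribution x ψ s p q (J φ) = (φ : 𝓢'(Euc d, ℂ)) := by
  obtain ⟨C, N, hC, h⟩ := exists_funNorm_schwartz_le hU hψ s (Fact.out : 1 ≤ p) (Fact.out : 1 ≤ q)
  have hd := fun φ => isDensity_schwartz hU hψ (Fact.out : 1 ≤ p) φ
  choose J hJ using fun φ => exists_of_isDensity (hd φ) ((h φ).trans_lt ENNReal.ofReal_lt_top)
  -- `SchwartzMap.mkCLMtoNormedSpace` asks for a norm; the topology is that of the seminorm
  let _ : NormedAddCommGroup (DecompSpace x ψ s p q) :=
    NormedAddCommGroup.ofSeparation (eq_zero_of_norm_eq_zero hU hψ)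
  let J' : 𝓢(Euc d, ℂ) →L[ℂ] DecompSpace x ψ s p q := SchwartzMap.mkCLMtoNormedSpace J
    (fun φ χ => toDistribution_injective (by rw [map_add, hJ, hJ, hJ, map_add]))
    (fun c φ => toDistribution_injective (by rw [map_smul, hJ, hJ, map_smul]; rfl))
    ⟨Finset.Iic (N, N), C, hC, fun φ => by
      have h1 := h φ
      rwa [← ofReal_norm_eq (J φ) (by rw [hJ]; exact hd φ),
        ENNReal.ofReal_le_ofReal_iff (by positivity)] at h1⟩
  exact ⟨J', hJ⟩

theorem completeSpace [Countable ι] (hU : IsWeightedCovering U x) (hψ : IsBAPU U ψ) :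
    CompleteSpace (DecompSpace x ψ s p q) := by
  have hp : 1 ≤ p := Fact.out
  have hq : 1 ≤ q := Fact.out
  refine Metric.complete_of_cauchySeq_tendsto fun u hu => ?_
  choose F hF using fun n => exists_density hU hψ (u n)
  have hsub : ∀ n m, ENNReal.ofReal ‖u n - u m‖ = funNorm p q x ψ s fun y => F n y - F m y :=
    fun n m => ofReal_norm_eq _ (by rw [map_sub]; exact (hF n).sub (hF m))
  set v : ι → ℕ → Lp ℂ p (volume : Measure (Euc d)) := fun i n => ((hF n).memLp i).toLp _ with hv
  have hvsub : ∀ i n (G : Euc d → ℂ) (hG : MemLp (fun y => (ψ i y : ℂ) * G y) p volume),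
      eLpNorm (fun y => (ψ i y : ℂ) * (F n y - G y)) p volume = ‖v i n - hG.toLp _‖ₑ := by
    intro i n G hG
    rw [hv, ← MemLp.toLp_sub, Lp.enorm_toLp]
    congr 1
    ext y
    simp [mul_sub]
  have hterm : ∀ i n m, ENNReal.ofReal (weight x i ^ s) * ‖v i n - v i m‖ₑ ≤
      ENNReal.ofReal ‖u n - u m‖ := fun i n m => by
    rw [hsub, ← hvsub]
    exact le_lqNorm hq (fun i => ENNReal.ofReal (weight x i ^ s) *
      eLpNorm (fun y => (ψ i y : ℂ) * (F n y - F m y)) p volume) i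
  -- the localisations converge in `L^p`
  have hcauchy : ∀ i, CauchySeq (v i) := fun i => by
    have hw : 0 < weight x i ^ s := Real.rpow_pos_of_pos (weight_pos x i) s
    rw [Metric.cauchySeq_iff] at hu ⊢
    intro ε hε
    obtain ⟨N, hN⟩ := hu (weight x i ^ s * ε) (by positivity)
    refine ⟨N, fun m hm n hn => ?_⟩
    have h1 := hterm i m n
    rw [← ofReal_norm, ← ENNReal.ofReal_mul hw.le,
      ENNReal.ofReal_le_ofReal_iff (norm_nonneg _)] at h1
    have h2 := hN m hm n hn
    rw [dist_eq_norm] at h2 ⊢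
    exact lt_of_mul_lt_mul_left (h1.trans_lt h2) hw.le
  choose g hg using fun i => cauchySeq_tendsto_of_complete (hcauchy i)
  have hcomp : ∀ i j, (fun y => (ψ j y : ℂ) * g i y) =ᵐ[volume] fun y => (ψ i y : ℂ) * g j y := by
    intro i j
    have hmem : ∀ i j, MemLp (fun y => (ψ j y : ℂ) * g i y) p volume := fun i j =>
      memLp_partition_mul hψ (Lp.memLp (g i)) j
    have hlim : ∀ i, Tendsto (fun n => ‖v i n - g i‖ₑ) atTop (𝓝 0) := fun i => by
      simpa using ((hg i).sub_const (g i)).enorm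
    have hle : ∀ n, eLpNorm (fun y => (ψ j y : ℂ) * g i y - (ψ i y : ℂ) * g j y) p volume ≤
        ‖v i n - g i‖ₑ + ‖v j n - g j‖ₑ := fun n => by
      have key : ∀ i, eLpNorm (fun y => (ψ i y : ℂ) * F n y - g i y) p volume = ‖v i n - g i‖ₑ := by
        intro i
        nth_rewrite 2 [← Lp.toLp_coeFn (g i) (Lp.memLp (g i))]
        rw [hv, ← MemLp.toLp_sub, Lp.enorm_toLp]
        rfl
      have hm : ∀ i, AEStronglyMeasurable (fun y => (ψ i y : ℂ) * F n y - g i y) volume := fun i =>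
        ((hF n).memLp i).1.sub (Lp.memLp (g i)).1
      rw [← key, ← key, add_comm]
      have h1 : (fun y => (ψ j y : ℂ) * g i y - (ψ i y : ℂ) * g j y) =
          (fun y => (ψ i y : ℂ) * ((ψ j y : ℂ) * F n y - g j y)) -
            fun y => (ψ j y : ℂ) * ((ψ i y : ℂ) * F n y - g i y) := by
        ext y
        simp only [Pi.sub_apply]
        ring
      rw [h1]
      refine (eLpNorm_sub_le ((hψ.continuous i).aestronglyMeasurable.mul (hm j))
        ((hψ.continuous j).aestronglyMeasurable.mul (hm i)) hp).trans ?_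
      exact add_le_add (hψ.eLpNorm_mul_le _ _ _) (hψ.eLpNorm_mul_le _ _ _)
    have h0 : eLpNorm (fun y => (ψ j y : ℂ) * g i y - (ψ i y : ℂ) * g j y) p volume = 0 := by
      have hlim2 : Tendsto (fun n => ‖v i n - g i‖ₑ + ‖v j n - g j‖ₑ) atTop (𝓝 0) := by
        simpa using (hlim i).add (hlim j)
      exact le_antisymm (ge_of_tendsto' hlim2 hle) zero_le
    filter_upwards [(eLpNorm_eq_zero_iff ((hmem i j).1.sub (hmem j i).1)
      (zero_lt_one.trans_le hp).ne').1 h0] with y hy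
    exact sub_eq_zero.1 hy
  obtain ⟨G, hG, hGg⟩ := exists_glue hU hψ (fun i => (Lp.memLp (g i)).1) hcomp
  have hGmem : ∀ i, MemLp (fun y => (ψ i y : ℂ) * G y) p volume := fun i =>
    (memLp_congr_ae (hGg i)).2 (Lp.memLp (g i))
  have hGv : ∀ i, (hGmem i).toLp _ = g i := fun i => by
    rw [MemLp.toLp_congr (hGmem i) (Lp.memLp (g i)) (hGg i), Lp.toLp_coeFn]
  -- the tail estimate passes to the limit by lower semicontinuity
  have htail : ∀ ε : ℝ, 0 < ε → ∃ N, ∀ n ≥ N,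
      (funNorm p q x ψ s fun y => F n y - G y) ≤ ENNReal.ofReal ε := by
    intro ε hε
    obtain ⟨N, hN⟩ := Metric.cauchySeq_iff.1 hu ε hε
    refine ⟨N, fun n hn => ?_⟩
    refine lqNorm_le_of_tendsto hq (u := fun m i => ENNReal.ofReal (weight x i ^ s) *
      eLpNorm (fun y => (ψ i y : ℂ) * (F n y - F m y)) p volume) (fun i => ?_) ?_
    · simp_rw [hvsub i n G (hGmem i), fun m => hvsub i n (F m) ((hF m).memLp i), hGv]
      refine ENNReal.Tendsto.const_mul ?_ (Or.inr ENNReal.ofReal_ne_top)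
      exact ((hg i).const_sub (v i n)).enorm
    · filter_upwards [eventually_ge_atTop N] with m hm
      change funNorm p q x ψ s (fun y => F n y - F m y) ≤ _
      rw [← hsub]
      refine ENNReal.ofReal_le_ofReal ?_
      rw [← dist_eq_norm]
      exact (hN n hn m hm).le
  obtain ⟨N₁, hN₁⟩ := htail 1 one_pos
  obtain ⟨w, hw⟩ := exists_of_funNorm_lt_top (p := p) (q := q) (s := s) hU hψ ((hF N₁).1.sub hG)
    ((hN₁ N₁ le_rfl).trans_lt ENNReal.ofReal_lt_top)
  have hlimit : IsDensity p ψ (toDistribution x ψ s p q (u N₁ - w)) G := by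
    rw [map_sub]
    convert! (hF N₁).sub hw using 1
    ext y
    simp
  refine ⟨u N₁ - w, Metric.tendsto_atTop.2 fun ε hε => ?_⟩
  obtain ⟨N, hN⟩ := htail (ε / 2) (by positivity)
  refine ⟨N, fun n hn => ?_⟩
  have h1 := hN n hn
  rw [← ofReal_norm_eq (u n - (u N₁ - w)) (by rw [map_sub]; exact (hF n).sub hlimit),
    ENNReal.ofReal_le_ofReal_iff (by positivity)] at h1
  rw [dist_eq_norm]
  linarith

end DecompSpace

/-! ### Synthesis from local pieces -/

section Synthesis

variable {d : ℕ} {ι : Type*} {U : ι → Set (Euc d)} {x : ι → Euc d} {ψ : ι → Euc d → ℝ}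
  {p q : ℝ≥0∞} {s : ℝ}

theorem IsDensity.congr_ae {f : 𝓢'(Euc d, ℂ)} {F G : Euc d → ℂ} (hF : IsDensity p ψ f F)
    (hFG : F =ᵐ[volume] G) : IsDensity p ψ f G := by
  have h : ∀ i, (fun y => (ψ i y : ℂ) * F y) =ᵐ[volume] fun y => (ψ i y : ℂ) * G y := fun i => by
    filter_upwards [hFG] with y hy
    rw [hy]
  refine ⟨hF.1.congr hFG, fun i => (memLp_congr_ae (h i)).1 (hF.memLp i), fun i φ => ?_⟩
  rw [hF.cutoff_apply]
  refine integral_congr_ae ?_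
  filter_upwards [h i] with y hy
  rw [hy]

theorem IsDensity.zero : IsDensity p ψ 0 fun _ => 0 where
  aestronglyMeasurable := aestronglyMeasurable_const
  memLp i := by simp
  cutoff_apply i φ := by
    rw [map_zero]
    simp only [mul_zero, integral_zero]
    rfl

theorem IsDensity.sum [Fact (1 ≤ p)] {κ : Type*} (I : Finset κ) {f : κ → 𝓢'(Euc d, ℂ)}
    {F : κ → Euc d → ℂ} (h : ∀ i ∈ I, IsDensity p ψ (f i) (F i)) :
    IsDensity p ψ (∑ i ∈ I, f i) fun y => ∑ i ∈ I, F i y := by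
  classical
  induction I using Finset.induction_on with
  | empty => simpa using IsDensity.zero
  | insert i I hi ih =>
    simp_rw [Finset.sum_insert hi]
    exact (h i (Finset.mem_insert_self i I)).add
      (ih fun j hj => h j (Finset.mem_insert_of_mem hj))

/-- The norm of a sum of functions `w_i` supported in the members `U_i` of the covering is
controlled by the `L^p` norms of the `w_i`. -/
theorem exists_funNorm_le_of_hasSum (hU : IsWeightedCovering U x) (hψ : IsBAPU U ψ)
    (s : ℝ) (hp : 1 ≤ p) (hq : 1 ≤ q) :
    ∃ C : ℝ, 0 ≤ C ∧ ∀ (F : Euc d → ℂ) (w : ι → Euc d → ℂ),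
      (∀ i, AEStronglyMeasurable (w i) volume) → (∀ i, ∀ y ∉ U i, w i y = 0) →
      (∀ y, HasSum (fun i => w i y) (F y)) → funNorm p q x ψ s F ≤ ENNReal.ofReal C *
        lqNorm q (fun i => ENNReal.ofReal (weight x i ^ s) * eLpNorm (w i) p volume) := by
  obtain ⟨N, n₀, hcard, hN⟩ := hU.admissible.exists_neighbours
  obtain ⟨C, hC, hw⟩ := hU.exists_weight_rpow_le s
  have hsymm : ∀ i j, j ∈ N i ↔ i ∈ N j := fun i j => by rw [hN, hN, inter_comm]
  refine ⟨C * n₀, by positivity, fun F w hm hsupp hsum => ?_⟩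
  have hlocal : ∀ k, eLpNorm (fun y => (ψ k y : ℂ) * F y) p volume ≤
      ∑ i ∈ N k, eLpNorm (w i) p volume := fun k => by
    refine le_trans (eLpNorm_mono_enorm (g := ∑ i ∈ N k, w i) fun y => ?_)
      (eLpNorm_sum_le (fun i _ => hm i) hp)
    by_cases hy : y ∈ U k
    · have h1 : HasSum (fun i => w i y) (∑ i ∈ N k, w i y) :=
        hasSum_sum_of_ne_finset_zero fun i hi =>
          hsupp i y fun hyi => hi ((hN k i).2 ⟨y, hyi, hy⟩)
      rw [Finset.sum_apply, ← (hsum y).unique h1, enorm_mul]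
      exact mul_le_of_le_one_left zero_le (hψ.enorm_le_one k y)
    · simp [hψ.eq_zero_of_notMem hy]
  calc funNorm p q x ψ s F
      ≤ lqNorm q (fun k => ENNReal.ofReal C * ∑ i ∈ N k,
          ENNReal.ofReal (weight x i ^ s) * eLpNorm (w i) p volume) := by
        refine lqNorm_mono q fun k => ?_
        refine (mul_le_mul_right (hlocal k) _).trans ?_
        rw [Finset.mul_sum, Finset.mul_sum]
        refine Finset.sum_le_sum fun i hi => ?_
        rw [← mul_assoc, ← ENNReal.ofReal_mul hC]
        gcongr
        exact hw k i ((hN k i).1 hi)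
    _ ≤ ENNReal.ofReal C * (n₀ * lqNorm q (fun i => ENNReal.ofReal (weight x i ^ s) *
          eLpNorm (w i) p volume)) := by
        rw [lqNorm_const_mul hq]
        gcongr
        exact lqNorm_sum_neighbours_le hq hcard hsymm _
    _ = _ := by
        rw [ENNReal.ofReal_mul hC, ENNReal.ofReal_natCast]
        ring

namespace DecompSpace

variable [Fact (1 ≤ p)] [Fact (1 ≤ q)]

theorem eq_of_isDensity [Countable ι] (hU : IsWeightedCovering U x) (hψ : IsBAPU U ψ)
    {f g : DecompSpace x ψ s p q} {F G : Euc d → ℂ}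
    (hf : IsDensity p ψ (toDistribution x ψ s p q f) F)
    (hg : IsDensity p ψ (toDistribution x ψ s p q g) G) (hFG : F =ᵐ[volume] G) : f = g := by
  apply toDistribution_injective
  ext φ
  rw [apply_eq_integral hU hψ f (hf.congr_ae hFG), apply_eq_integral hU hψ g hg]

theorem isDensity_sum (I : Finset ι) {f : ι → DecompSpace x ψ s p q} {F : ι → Euc d → ℂ}
    (h : ∀ i ∈ I, IsDensity p ψ (toDistribution x ψ s p q (f i)) (F i)) :
    IsDensity p ψ (toDistribution x ψ s p q (∑ i ∈ I, f i)) fun y => ∑ i ∈ I, F i y := by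
  rw [map_sum]
  exact IsDensity.sum I h

/-- The synthesis `v ↦ ψ_i v` from `L^p` to the decomposition space. -/
theorem exists_partition_mul [Countable ι] (hU : IsWeightedCovering U x) (hψ : IsBAPU U ψ)
    (i : ι) :
    ∃ C : ℝ, 0 ≤ C ∧ ∀ v : Euc d → ℂ, MemLp v p volume → ∃ f : DecompSpace x ψ s p q,
      IsDensity p ψ (toDistribution x ψ s p q f) (fun y => (ψ i y : ℂ) * v y) ∧
      ENNReal.ofReal ‖f‖ ≤ ENNReal.ofReal C * eLpNorm v p volume := by
  classical
  obtain ⟨C, hC, h⟩ := exists_funNorm_le_of_hasSum (p := p) (q := q) hU hψ s Fact.out Fact.out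
  have hω : 0 ≤ weight x i ^ s := (Real.rpow_pos_of_pos (weight_pos x i) s).le
  refine ⟨C * weight x i ^ s, by positivity, fun v hv => ?_⟩
  have hm : AEStronglyMeasurable (fun y => (ψ i y : ℂ) * v y) volume :=
    (hψ.continuous i).aestronglyMeasurable.mul hv.1
  have h1 := h (fun y => (ψ i y : ℂ) * v y)
    (fun j y => if j = i then (ψ i y : ℂ) * v y else 0)
    (fun j => by
      split_ifs
      exacts [hm, aestronglyMeasurable_const])
    (fun j y hy => by
      split_ifs with hj
      · subst hj
        simp [hψ.eq_zero_of_notMem hy]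
      · rfl)
    (fun y => hasSum_ite_eq i _)
  have h2 : lqNorm q (fun j => ENNReal.ofReal (weight x j ^ s) *
      eLpNorm (fun y => if j = i then (ψ i y : ℂ) * v y else 0) p volume) ≤
      ENNReal.ofReal (weight x i ^ s) * eLpNorm v p volume := by
    refine (lqNorm_le_tsum (Fact.out : 1 ≤ q) _).trans ?_
    rw [tsum_eq_single i fun j hj => by simp [hj]]
    simp only [if_true]
    gcongr
    exact hψ.eLpNorm_mul_le i v p
  have h3 : funNorm p q x ψ s (fun y => (ψ i y : ℂ) * v y) ≤
      ENNReal.ofReal (C * weight x i ^ s) * eLpNorm v p volume := by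
    rw [ENNReal.ofReal_mul hC, mul_assoc]
    exact h1.trans (mul_le_mul_right h2 _)
  obtain ⟨f, hf⟩ := exists_of_funNorm_lt_top (q := q) (s := s) hU hψ hm
    (h3.trans_lt (ENNReal.mul_lt_top ENNReal.ofReal_lt_top hv.2))
  exact ⟨f, hf, by rwa [ofReal_norm_eq f hf]⟩

theorem memLp_indicator_of_isDensity (hU : IsWeightedCovering U x) (hψ : IsBAPU U ψ)
    {f : 𝓢'(Euc d, ℂ)} {F : Euc d → ℂ} (hF : IsDensity p ψ f F) (i : ι) :
    MemLp ((U i).indicator F) p volume := by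
  obtain ⟨N, n₀, -, hN⟩ := hU.admissible.exists_neighbours
  refine ⟨hF.1.indicator (hU.isOpen i).measurableSet, ?_⟩
  refine (eLpNorm_indicator_le_sum_neighbours hψ hN Fact.out hF.1 i).trans_lt ?_
  exact ENNReal.sum_lt_top.2 fun j _ => (hF.memLp j).2

theorem partition_mul_indicator (hψ : IsBAPU U ψ) (F : Euc d → ℂ) (i : ι) :
    (fun y => (ψ i y : ℂ) * (U i).indicator F y) = fun y => (ψ i y : ℂ) * F y := by
  ext y
  by_cases hy : y ∈ U i
  · rw [indicator_of_mem hy]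
  · simp [hψ.eq_zero_of_notMem hy]

theorem exists_localisation [Countable ι] (hU : IsWeightedCovering U x) (hψ : IsBAPU U ψ)
    {f : 𝓢'(Euc d, ℂ)} {F : Euc d → ℂ} (hF : IsDensity p ψ f F) (i : ι) :
    ∃ g : DecompSpace x ψ s p q,
      IsDensity p ψ (toDistribution x ψ s p q g) (fun y => (ψ i y : ℂ) * F y) := by
  obtain ⟨C, -, h⟩ := exists_partition_mul (s := s) (p := p) (q := q) hU hψ i
  obtain ⟨g, hg, -⟩ := h _ (memLp_indicator_of_isDensity hU hψ hF i)
  rw [partition_mul_indicator hψ] at hg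
  exact ⟨g, hg⟩

/-- For `q < ∞` the localisations of an element sum up to the element. -/
theorem hasSum_localisations [Countable ι] (hU : IsWeightedCovering U x) (hψ : IsBAPU U ψ)
    (hq : q ≠ ⊤) {f : DecompSpace x ψ s p q} {F : Euc d → ℂ}
    (hF : IsDensity p ψ (toDistribution x ψ s p q f) F) {g : ι → DecompSpace x ψ s p q}
    (hg : ∀ i, IsDensity p ψ (toDistribution x ψ s p q (g i)) (fun y => (ψ i y : ℂ) * F y)) :
    HasSum g f := by
  classical
  obtain ⟨C, hC, h⟩ := exists_funNorm_le_of_hasSum (p := p) (q := q) hU hψ s Fact.out Fact.out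
  set a : ι → ℝ≥0∞ := fun i => ENNReal.ofReal (weight x i ^ s) *
    eLpNorm (fun y => (ψ i y : ℂ) * F y) p volume with ha
  have hle : ∀ I : Finset ι, ENNReal.ofReal ‖f - ∑ i ∈ I, g i‖ ≤
      ENNReal.ofReal C * lqNorm q (indicator (I : Set ι)ᶜ a) := fun I => by
    have hd : IsDensity p ψ (toDistribution x ψ s p q (f - ∑ i ∈ I, g i))
        (fun y => F y - ∑ i ∈ I, (ψ i y : ℂ) * F y) := by
      rw [map_sub]
      exact hF.sub (isDensity_sum I fun i _ => hg i)
    rw [ofReal_norm_eq _ hd]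
    refine (h _ (fun i y => if i ∈ I then 0 else (ψ i y : ℂ) * F y) (fun i => ?_)
      (fun i y hy => ?_) fun y => ?_).trans (mul_le_mul_right (lqNorm_mono q fun i => ?_) _)
    · split_ifs
      exacts [aestronglyMeasurable_const, (hF.memLp i).1]
    · simp [hψ.eq_zero_of_notMem hy]
    · have h1 : HasSum (fun i => (ψ i y : ℂ) * F y) (F y) := by
        simpa using (Complex.hasSum_ofReal.2 (hψ.sum_eq_one y)).mul_right (F y)
      have h2 : HasSum (fun i => if i ∈ I then (ψ i y : ℂ) * F y else 0)
          (∑ i ∈ I, (ψ i y : ℂ) * F y) := by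
        have h3 := hasSum_sum_of_ne_finset_zero
          (f := fun i => if i ∈ I then (ψ i y : ℂ) * F y else 0) (s := I)
          (L := SummationFilter.unconditional ι) fun i hi => if_neg hi
        rwa [Finset.sum_congr rfl fun i hi => if_pos hi] at h3
      refine (h1.sub h2).congr_fun ?_
      intro i
      split_ifs <;> simp
    · by_cases hi : i ∈ I
      · simp [hi]
      · simp [hi, ha]
  have hfin : lqNorm q a ≠ ⊤ := (funNorm_lt_top f hF).ne
  have hlim := ENNReal.Tendsto.const_mul (a := ENNReal.ofReal C)
    (tendsto_lqNorm_compl_zero Fact.out hq hfin) (Or.inr ENNReal.ofReal_ne_top)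
  rw [mul_zero] at hlim
  have h0 := tendsto_of_tendsto_of_tendsto_of_le_of_le tendsto_const_nhds hlim
    (fun _ => zero_le) hle
  have h1 := (ENNReal.tendsto_toReal ENNReal.zero_ne_top).comp h0
  rw [HasSum, SummationFilter.unconditional_filter, tendsto_iff_norm_sub_tendsto_zero]
  refine h1.congr fun I => ?_
  rw [Function.comp_apply, ENNReal.toReal_ofReal (norm_nonneg _), norm_sub_rev]

/-- The pairing `(σ, f) ↦ ∫ f σ` of the decomposition spaces of conjugate exponents and opposite
weights. -/
theorem exists_pairing [Countable ι] (hU : IsWeightedCovering U x) (hψ : IsBAPU U ψ) (s : ℝ)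
    {p' q' : ℝ≥0∞} [Fact (1 ≤ p')] [Fact (1 ≤ q')] (hp : p.HolderConjugate p')
    (hq : q.HolderConjugate q') :
    ∃ B : DecompSpace x ψ (-s) p' q' →L[ℂ] DecompSpace x ψ s p q →L[ℂ] ℂ, ∀ σ f F H,
      IsDensity p ψ (toDistribution x ψ s p q f) F →
      IsDensity p' ψ (toDistribution x ψ (-s) p' q' σ) H → B σ f = ∫ y, F y * H y := by
  obtain ⟨C, hC, hle⟩ := exists_lintegral_mul_le hU hψ s hp hq
  choose D hD using fun f : DecompSpace x ψ s p q => exists_density hU hψ f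
  choose D' hD' using fun σ : DecompSpace x ψ (-s) p' q' => exists_density hU hψ σ
  have hbound : ∀ f σ F H, IsDensity p ψ (toDistribution x ψ s p q f) F →
      IsDensity p' ψ (toDistribution x ψ (-s) p' q' σ) H →
      ∫⁻ y, ‖F y * H y‖ₑ ≤ ENNReal.ofReal (C * ‖σ‖ * ‖f‖) := fun f σ F H hF hH => by
    refine (hle F H hF.1 hH.1).trans (le_of_eq ?_)
    rw [ENNReal.ofReal_mul (by positivity), ENNReal.ofReal_mul hC, ofReal_norm_eq f hF,
      ofReal_norm_eq σ hH]
    ring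
  have hint : ∀ f σ F H, IsDensity p ψ (toDistribution x ψ s p q f) F →
      IsDensity p' ψ (toDistribution x ψ (-s) p' q' σ) H →
      Integrable (fun y => F y * H y) := fun f σ F H hF hH =>
    ⟨hF.1.mul hH.1, (hbound f σ F H hF hH).trans_lt ENNReal.ofReal_lt_top⟩
  have heq : ∀ f σ F H, IsDensity p ψ (toDistribution x ψ s p q f) F →
      IsDensity p' ψ (toDistribution x ψ (-s) p' q' σ) H →
      ∫ y, D f y * D' σ y = ∫ y, F y * H y := fun f σ F H hF hH => by
    refine integral_congr_ae ?_
    filter_upwards [(hD f).ae_eq hψ hF, (hD' σ).ae_eq hψ hH] with y h1 h2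
    rw [h1, h2]
  let L : DecompSpace x ψ (-s) p' q' →ₗ[ℂ] DecompSpace x ψ s p q →ₗ[ℂ] ℂ :=
    LinearMap.mk₂ ℂ (fun σ f => ∫ y, D f y * D' σ y)
      (fun σ τ f => by
        rw [heq f (σ + τ) _ _ (hD f) (by rw [map_add]; exact (hD' σ).add (hD' τ)),
          ← integral_add (hint f σ _ _ (hD f) (hD' σ)) (hint f τ _ _ (hD f) (hD' τ))]
        simp_rw [mul_add])
      (fun c σ f => by
        rw [heq f (c • σ) _ _ (hD f) (by rw [map_smul]; exact (hD' σ).smul c), smul_eq_mul,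
          ← integral_const_mul]
        simp_rw [mul_left_comm])
      (fun σ f g => by
        rw [heq (f + g) σ _ _ (by rw [map_add]; exact (hD f).add (hD g)) (hD' σ),
          ← integral_add (hint f σ _ _ (hD f) (hD' σ)) (hint g σ _ _ (hD g) (hD' σ))]
        simp_rw [add_mul])
      (fun c σ f => by
        rw [heq (c • f) σ _ _ (by rw [map_smul]; exact (hD f).smul c) (hD' σ), smul_eq_mul,
          ← integral_const_mul]
        simp_rw [mul_assoc])
  refine ⟨L.mkContinuous₂ C fun σ f => ?_, fun σ f F H hF hH => heq f σ F H hF hH⟩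
  have h1 := (enorm_integral_le_lintegral_enorm (μ := volume) fun y => D f y * D' σ y).trans
    (hbound f σ _ _ (hD f) (hD' σ))
  rw [← ofReal_norm, ENNReal.ofReal_le_ofReal_iff (by positivity)] at h1
  exact h1

end DecompSpace

end Synthesis

/-! ### Duality -/

section Duality

variable {d : ℕ} {ι : Type*} {U : ι → Set (Euc d)} {x : ι → Euc d} {ψ : ι → Euc d → ℝ}
  {p q : ℝ≥0∞} {s : ℝ}

namespace DecompSpace

variable [Fact (1 ≤ p)] [Fact (1 ≤ q)]

/-- A functional on the decomposition space acts on the functions supported in one member of the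
covering by integration against an `L^{p'}` function; the norm of that function is attained up to
the factor `2` on a unit vector of `L^p`. -/
theorem exists_local_representative [Countable ι] (hU : IsWeightedCovering U x)
    (hψ : IsBAPU U ψ) {p' : ℝ≥0∞} (hpp : p.HolderConjugate p') (hp : p ≠ ⊤)
    (Λ : DecompSpace x ψ s p q →L[ℂ] ℂ) (i : ι) :
    ∃ g : Euc d → ℂ, MemLp g p' volume ∧
      (∀ v, MemLp v p volume → ∀ f : DecompSpace x ψ s p q,
        IsDensity p ψ (toDistribution x ψ s p q f) (fun y => (ψ i y : ℂ) * v y) →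
        Λ f = ∫ y, g y * v y) ∧
      ∃ v, MemLp v p volume ∧ eLpNorm v p volume ≤ 1 ∧
        ∃ f : DecompSpace x ψ s p q,
          IsDensity p ψ (toDistribution x ψ s p q f) (fun y => (ψ i y : ℂ) * v y) ∧
          ∃ r : ℝ, 0 ≤ r ∧ Λ f = r ∧ eLpNorm g p' volume ≤ ENNReal.ofReal (2 * r) := by
  have hUm : MeasurableSet (U i) := (hU.isOpen i).measurableSet
  -- `U_i` has finite measure, as the representation of functionals on `L^p` below requires
  set μ : Measure (Euc d) := volume.restrict (U i) with hμ
  have : IsFiniteMeasure μ := ⟨by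
    rw [hμ, Measure.restrict_apply_univ]
    exact (hU.volume_ne_top i).lt_top⟩
  obtain ⟨C, hC, hsyn⟩ := exists_partition_mul (s := s) (p := p) (q := q) hU hψ i
  have hext : ∀ u : Lp ℂ p μ, MemLp ((U i).indicator u) p volume := fun u =>
    (memLp_indicator_iff_restrict hUm).2 (Lp.memLp u)
  have hextn : ∀ u : Lp ℂ p μ, eLpNorm ((U i).indicator u) p volume = ENNReal.ofReal ‖u‖ :=
    fun u => by
      rw [eLpNorm_indicator_eq_eLpNorm_restrict hUm, ofReal_norm, Lp.enorm_def]
  choose S hS hSn using fun u : Lp ℂ p μ => hsyn _ (hext u)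
  have hae : ∀ {u v : Euc d → ℂ}, u =ᵐ[μ] v →
      (fun y => (ψ i y : ℂ) * (U i).indicator u y) =ᵐ[volume]
        fun y => (ψ i y : ℂ) * (U i).indicator v y := fun {u v} huv => by
    filter_upwards [(ae_restrict_iff' hUm).1 huv] with y hy
    by_cases hyU : y ∈ U i
    · rw [indicator_of_mem hyU, indicator_of_mem hyU, hy hyU]
    · rw [indicator_of_notMem hyU, indicator_of_notMem hyU]
  have hadd : ∀ u v, S (u + v) = S u + S v := fun u v => by
    refine eq_of_isDensity hU hψ (hS _) (by rw [map_add]; exact (hS u).add (hS v)) ?_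
    filter_upwards [hae (Lp.coeFn_add u v)] with y hy
    rw [hy, indicator_add']
    simp only [Pi.add_apply, mul_add]
  have hsmul : ∀ (c : ℂ) u, S (c • u) = c • S u := fun c u => by
    refine eq_of_isDensity hU hψ (hS _) (by rw [map_smul]; exact (hS u).smul c) ?_
    filter_upwards [hae (Lp.coeFn_smul c u)] with y hy
    rw [hy]
    by_cases hyU : y ∈ U i
    · simp [hyU, mul_left_comm]
    · simp [hyU]
  let S' : Lp ℂ p μ →L[ℂ] DecompSpace x ψ s p q := LinearMap.mkContinuous
    { toFun := S, map_add' := hadd, map_smul' := hsmul } C fun u => by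
      have h1 := hSn u
      rw [hextn, ← ENNReal.ofReal_mul hC, ENNReal.ofReal_le_ofReal_iff (by positivity)] at h1
      exact h1
  obtain ⟨h, hh, hhn, hrep⟩ := exists_memLp_eq_integral_mul hpp hp (Λ ∘L S')
  have hΛ : ∀ v, MemLp v p volume → ∀ f : DecompSpace x ψ s p q,
      IsDensity p ψ (toDistribution x ψ s p q f) (fun y => (ψ i y : ℂ) * v y) →
      Λ f = ∫ y, (U i).indicator h y * v y := fun v hv f hf => by
    have hv' : MemLp v p μ := hv.mono_measure Measure.restrict_le_self
    have h1 : f = S' (hv'.toLp v) := by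
      refine eq_of_isDensity hU hψ hf (hS _) ?_
      rw [← partition_mul_indicator hψ v i]
      exact hae hv'.coeFn_toLp.symm
    have h2 := hrep (hv'.toLp v)
    rw [ContinuousLinearMap.comp_apply, ← h1] at h2
    have h3 : ∀ y, (U i).indicator h y * v y = (U i).indicator (fun y => h y * v y) y :=
      fun y => by
        by_cases hyU : y ∈ U i
        · simp [hyU]
        · simp [hyU]
    rw [h2, integral_congr_ae (Eventually.of_forall h3), integral_indicator hUm]
    refine integral_congr_ae ?_
    filter_upwards [hv'.coeFn_toLp] with y hy
    rw [hy]
  refine ⟨(U i).indicator h, (memLp_indicator_iff_restrict hUm).2 hh, hΛ, ?_⟩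
  rw [eLpNorm_indicator_eq_eLpNorm_restrict hUm]
  rcases eq_or_ne (Λ ∘L S') 0 with h0 | h0
  · refine ⟨fun _ => 0, MemLp.zero, by simp, 0, ?_, 0, le_rfl, by simp, ?_⟩
    · simpa using IsDensity.zero
    · rw [← ofReal_norm, norm_eq_zero.2 h0, ENNReal.ofReal_zero] at hhn
      exact hhn.trans zero_le
  · have hpos : 0 < ‖Λ ∘L S'‖ := norm_pos_iff.2 h0
    obtain ⟨u, hu1, hu2⟩ := ContinuousLinearMap.exists_lt_apply_of_lt_opNorm (Λ ∘L S')
      (half_lt_self hpos)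
    set z := Λ (S' u) with hz
    have hz' : ‖Λ ∘L S'‖ / 2 < ‖z‖ := hu2
    have hz0 : (‖z‖ : ℂ) ≠ 0 := by
      exact_mod_cast ((half_pos hpos).trans hz').ne'
    -- the phase makes the value of the functional non-negative
    set c : ℂ := (starRingEnd ℂ) z / ‖z‖ with hc
    have hcn : ‖c‖ = 1 := by
      rw [hc, norm_div, RCLike.norm_conj, Complex.norm_real, norm_norm, div_self]
      exact_mod_cast hz0
    refine ⟨_, hext (c • u), ?_, S (c • u), hS _, ‖z‖, norm_nonneg z, ?_, ?_⟩
    · rw [hextn, norm_smul, hcn, one_mul, ← ENNReal.ofReal_one]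
      exact ENNReal.ofReal_le_ofReal hu1.le
    · rw [hsmul, map_smul, smul_eq_mul, hc]
      change (starRingEnd ℂ) z / ‖z‖ * z = ‖z‖
      rw [div_mul_eq_mul_div, Complex.conj_mul', sq, mul_div_assoc, div_self hz0, mul_one]
    · refine hhn.trans ?_
      rw [← ofReal_norm]
      exact ENNReal.ofReal_le_ofReal (by linarith)

/-- Every functional on the decomposition space is given by integration against a function of
finite norm in the decomposition space of the conjugate exponents and the opposite weight. The
local representatives `g_i` are the localisations `ψ_i H` of one function `H`, whose norm is
estimated by the converse of Hölder's inequality for `ℓ^q`. -/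
theorem exists_representative [Countable ι] (hU : IsWeightedCovering U x) (hψ : IsBAPU U ψ)
    (s : ℝ) {p' q' : ℝ≥0∞} [Fact (1 ≤ p')] [Fact (1 ≤ q')] (hpp : p.HolderConjugate p')
    (hqq : q.HolderConjugate q') (hp : p ≠ ⊤) (hq : q ≠ ⊤) :
    ∃ K : ℝ, 0 ≤ K ∧ ∀ Λ : DecompSpace x ψ s p q →L[ℂ] ℂ,
      ∃ (σ : DecompSpace x ψ (-s) p' q') (H : Euc d → ℂ),
        IsDensity p' ψ (toDistribution x ψ (-s) p' q' σ) H ∧ ‖σ‖ ≤ K * ‖Λ‖ ∧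
        ∀ f F, IsDensity p ψ (toDistribution x ψ s p q f) F → Λ f = ∫ y, F y * H y := by
  classical
  obtain ⟨C, hC, hsyn⟩ := exists_funNorm_le_of_hasSum (p := p) (q := q) hU hψ s Fact.out Fact.out
  obtain ⟨B, hB⟩ := exists_pairing (p := p) (q := q) hU hψ s hpp hqq
  refine ⟨2 * C, by positivity, fun Λ => ?_⟩
  choose g hg hrep v hv hv1 f hf r hr hfr hgr using
    exists_local_representative hU hψ hpp hp Λ
  have hω : ∀ (t : ℝ) i, 0 < weight x i ^ t := fun t i => Real.rpow_pos_of_pos (weight_pos x i) t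
  -- both sides represent `v ↦ Λ (ψ_i ψ_j v)`
  have hcomp : ∀ i j, (fun y => (ψ j y : ℂ) * g i y) =ᵐ[volume] fun y => (ψ i y : ℂ) * g j y := by
    have hψp : ∀ j (A : Set (Euc d)), MeasurableSet A →
        MemLp (A.indicator fun y => (ψ j y : ℂ)) p volume := fun j A hA =>
      ((hψ.continuous j).memLp_of_hasCompactSupport
        ((hψ.hasCompactSupport j).comp_left Complex.ofReal_zero)).indicator hA
    have hint : ∀ i j, Integrable (fun y => (ψ j y : ℂ) * g i y) := fun i j => by
      have h1 := hψp j univ MeasurableSet.univ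
      rw [indicator_univ] at h1
      exact memLp_one_iff_integrable.1 ((hg i).mul h1)
    have hset : ∀ i j (A : Set (Euc d)), MeasurableSet A → ∀ f : DecompSpace x ψ s p q,
        IsDensity p ψ (toDistribution x ψ s p q f)
          (fun y => A.indicator (fun y => (ψ i y : ℂ) * ψ j y) y) →
        ∫ y in A, (ψ j y : ℂ) * g i y = Λ f := fun i j A hA f hf => by
      rw [hrep i _ (hψp j A hA) f, ← integral_indicator hA]
      · congr 1
        ext y
        by_cases hy : y ∈ A
        · simp [hy, mul_comm]
        · simp [hy]
      · convert! hf using 2 with y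
        by_cases hy : y ∈ A
        · simp [hy]
        · simp [hy]
    intro i j
    refine Integrable.ae_eq_of_forall_setIntegral_eq _ _ (hint i j) (hint j i)
      fun A hA _ => ?_
    obtain ⟨C', -, hC'⟩ := exists_partition_mul (s := s) (p := p) (q := q) hU hψ i
    obtain ⟨f, hf, -⟩ := hC' _ (hψp j A hA)
    have h1 : (fun y => (ψ i y : ℂ) * A.indicator (fun y => (ψ j y : ℂ)) y) =
        fun y => A.indicator (fun y => (ψ i y : ℂ) * ψ j y) y := by
      ext y
      by_cases hy : y ∈ A
      · simp [hy]
      · simp [hy]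
    rw [h1] at hf
    rw [hset i j A hA f hf, hset j i A hA f]
    simp_rw [mul_comm (ψ j _ : ℂ)]
    exact hf
  obtain ⟨H, hH, hHg⟩ := exists_glue hU hψ (fun i => (hg i).1) hcomp
  have hnorm : funNorm p' q' x ψ (-s) H ≤ ENNReal.ofReal (2 * C * ‖Λ‖) := by
    have h1 : funNorm p' q' x ψ (-s) H = lqNorm q' (fun i => ENNReal.ofReal (weight x i ^ (-s)) *
        eLpNorm (g i) p' volume) := by
      unfold funNorm
      congr 1
      ext i
      rw [eLpNorm_congr_ae (hHg i)]
    rw [h1]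
    refine lqNorm_le_of_forall_sum_mul_le hqq hq
      (fun i => ENNReal.mul_ne_top ENNReal.ofReal_ne_top (hg i).2.ne) fun I b hb => ?_
    -- the test vector is `∑ b_i ω_i^{-s} ψ_i v_i`
    set β : ι → ℝ := fun i => (b i).toReal * weight x i ^ (-s) with hβ
    have hβ0 : ∀ i, 0 ≤ β i := fun i => mul_nonneg ENNReal.toReal_nonneg (hω _ i).le
    set F₀ : DecompSpace x ψ s p q := ∑ i ∈ I, (β i : ℂ) • f i with hF₀
    have hd : IsDensity p ψ (toDistribution x ψ s p q F₀)
        (fun y => ∑ i ∈ I, (β i : ℂ) * ((ψ i y : ℂ) * v i y)) :=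
      isDensity_sum I fun i _ => by
        rw [map_smul]
        exact (hf i).smul _
    have hF₀n : ENNReal.ofReal ‖F₀‖ ≤ ENNReal.ofReal C * lqNorm q (indicator (I : Set ι) b) := by
      rw [ofReal_norm_eq _ hd]
      refine (hsyn _ (fun i y => if i ∈ I then (β i : ℂ) * ((ψ i y : ℂ) * v i y) else 0)
        (fun i => ?_) (fun i y hy => ?_) fun y => ?_).trans
        (mul_le_mul_right (lqNorm_mono q fun i => ?_) _)
      · split_ifs
        exacts [((hf i).smul _).1, aestronglyMeasurable_const]
      · simp [hψ.eq_zero_of_notMem hy]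
      · have h3 := hasSum_sum_of_ne_finset_zero
          (f := fun i => if i ∈ I then (β i : ℂ) * ((ψ i y : ℂ) * v i y) else 0) (s := I)
          (L := SummationFilter.unconditional ι) fun i hi => if_neg hi
        rwa [Finset.sum_congr rfl fun i hi => if_pos hi] at h3
      · by_cases hi : i ∈ I
        · have h4 : eLpNorm (fun y => (β i : ℂ) * ((ψ i y : ℂ) * v i y)) p volume ≤
              ENNReal.ofReal (β i) := by
            refine (eLpNorm_const_smul_le (c := (β i : ℂ))
              (f := fun y => (ψ i y : ℂ) * v i y)).trans ?_
            rw [← ofReal_norm, Complex.norm_real, Real.norm_of_nonneg (hβ0 i)]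
            exact mul_le_of_le_one_right zero_le ((hψ.eLpNorm_mul_le i _ p).trans (hv1 i))
          simp only [hi, if_true, Finset.mem_coe, indicator_of_mem]
          refine (mul_le_mul_right h4 _).trans (le_of_eq ?_)
          rw [← ENNReal.ofReal_mul (hω s i).le, hβ, mul_left_comm, ← Real.rpow_add (weight_pos x i),
            add_neg_cancel, Real.rpow_zero, mul_one, ENNReal.ofReal_toReal (hb i)]
        · simp [hi]
    have hΛF₀ : Λ F₀ = ((∑ i ∈ I, β i * r i : ℝ) : ℂ) := by
      rw [hF₀, map_sum, Complex.ofReal_sum]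
      refine Finset.sum_congr rfl fun i _ => ?_
      rw [map_smul, hfr, smul_eq_mul, ← Complex.ofReal_mul]
    have hsum0 : 0 ≤ ∑ i ∈ I, β i * r i := Finset.sum_nonneg fun i _ => mul_nonneg (hβ0 i) (hr i)
    have hΛn : ENNReal.ofReal (∑ i ∈ I, β i * r i) ≤
        ENNReal.ofReal ‖Λ‖ * ENNReal.ofReal ‖F₀‖ := by
      rw [← ENNReal.ofReal_mul (norm_nonneg _)]
      refine ENNReal.ofReal_le_ofReal ?_
      have h5 := Λ.le_opNorm F₀
      rwa [hΛF₀, Complex.norm_real, Real.norm_of_nonneg hsum0] at h5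
    calc ∑ i ∈ I, b i * (ENNReal.ofReal (weight x i ^ (-s)) * eLpNorm (g i) p' volume)
        ≤ ∑ i ∈ I, ENNReal.ofReal (2 * (β i * r i)) := by
          refine Finset.sum_le_sum fun i _ => ?_
          refine (mul_le_mul_right (mul_le_mul_right (hgr i) _) _).trans (le_of_eq ?_)
          rw [← ENNReal.ofReal_mul (hω _ i).le]
          nth_rewrite 1 [← ENNReal.ofReal_toReal (hb i)]
          rw [← ENNReal.ofReal_mul ENNReal.toReal_nonneg, hβ]
          congr 1
          ring
      _ = ENNReal.ofReal 2 * ENNReal.ofReal (∑ i ∈ I, β i * r i) := by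
          rw [← ENNReal.ofReal_sum_of_nonneg fun i _ =>
            mul_nonneg zero_le_two (mul_nonneg (hβ0 i) (hr i)), ← Finset.mul_sum,
            ENNReal.ofReal_mul zero_le_two]
      _ ≤ ENNReal.ofReal 2 * (ENNReal.ofReal ‖Λ‖ *
            (ENNReal.ofReal C * lqNorm q (indicator (I : Set ι) b))) := by
          gcongr
          exact hΛn.trans (mul_le_mul_right hF₀n _)
      _ = ENNReal.ofReal (2 * C * ‖Λ‖) * lqNorm q (indicator (I : Set ι) b) := by
          rw [ENNReal.ofReal_mul (by positivity), ENNReal.ofReal_mul zero_le_two]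
          ring
  obtain ⟨σ, hσ⟩ := exists_of_funNorm_lt_top (p := p') (q := q') (s := -s) hU hψ hH
    (hnorm.trans_lt ENNReal.ofReal_lt_top)
  refine ⟨σ, H, hσ, ?_, fun f F hF => ?_⟩
  · rw [← ofReal_norm_eq σ hσ, ENNReal.ofReal_le_ofReal_iff (by positivity)] at hnorm
    exact hnorm
  -- `Λ` and the pairing with `σ` agree on every `ψ_i F`, and these sum up to `f`
  · rw [← hB σ f F H hF hσ]
    choose φ hφ using fun i => exists_localisation (q := q) (s := s) hU hψ hF i
    have hsum := hasSum_localisations hU hψ hq hF hφ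
    refine (hsum.mapL Λ).unique ?_
    convert! hsum.mapL (B σ) using 2 with i
    rw [hB σ (φ i) _ H (hφ i) hσ, hrep i _ (memLp_indicator_of_isDensity hU hψ hF i) (φ i)
      (by rw [partition_mul_indicator hψ]; exact hφ i)]
    refine integral_congr_ae ?_
    filter_upwards [hHg i] with y hy
    rw [← hy, mul_right_comm, congrFun (partition_mul_indicator hψ F i) y]

/-- The dual of the decomposition space, under the pairing that extends `(σ, φ) ↦ σ φ`. -/
theorem exists_dual_equiv [Countable ι] (hU : IsWeightedCovering U x) (hψ : IsBAPU U ψ)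
    (s : ℝ) {p' q' : ℝ≥0∞} [Fact (1 ≤ p')] [Fact (1 ≤ q')] (hpp : p.HolderConjugate p')
    (hqq : q.HolderConjugate q') (hp : p ≠ ⊤) (hq : q ≠ ⊤) :
    ∃ Φ : DecompSpace x ψ (-s) p' q' ≃L[ℂ] (DecompSpace x ψ s p q →L[ℂ] ℂ),
      ∀ (σ : DecompSpace x ψ (-s) p' q') (f : DecompSpace x ψ s p q) (φ : 𝓢(Euc d, ℂ)),
        toDistribution x ψ s p q f = (φ : 𝓢'(Euc d, ℂ)) →
          Φ σ f = toDistribution x ψ (-s) p' q' σ φ := by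
  obtain ⟨B, hB⟩ := exists_pairing (p := p) (q := q) hU hψ s hpp hqq
  obtain ⟨K, hK, hrep⟩ := exists_representative (p := p) (q := q) hU hψ s hpp hqq hp hq
  have hBφ : ∀ (σ : DecompSpace x ψ (-s) p' q') (f : DecompSpace x ψ s p q) (φ : 𝓢(Euc d, ℂ)),
      toDistribution x ψ s p q f = (φ : 𝓢'(Euc d, ℂ)) →
        B σ f = toDistribution x ψ (-s) p' q' σ φ := fun σ f φ hf => by
    obtain ⟨H, hH⟩ := exists_density hU hψ σ
    rw [hB σ f φ H (by rw [hf]; exact isDensity_schwartz hU hψ Fact.out φ) hH,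
      apply_eq_integral hU hψ σ hH]
  obtain ⟨J, hJ⟩ := exists_schwartz_embedding (s := s) (p := p) (q := q) hU hψ
  have hinj : Injective B := by
    refine (injective_iff_map_eq_zero B).2 fun σ hσ => toDistribution_injective ?_
    ext φ
    rw [← hBφ σ (J φ) φ (hJ φ), hσ, map_zero]
    rfl
  have hinv : ∀ Λ, ∃ σ, ‖σ‖ ≤ K * ‖Λ‖ ∧ B σ = Λ := fun Λ => by
    obtain ⟨σ, H, hσ, hn, hΛ⟩ := hrep Λ
    refine ⟨σ, hn, ?_⟩
    ext f
    obtain ⟨F, hF⟩ := exists_density hU hψ f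
    rw [hB σ f F H hF hσ, hΛ f F hF]
  let e : DecompSpace x ψ (-s) p' q' ≃ₗ[ℂ] (DecompSpace x ψ s p q →L[ℂ] ℂ) :=
    LinearEquiv.ofBijective B.toLinearMap
      ⟨hinj, fun Λ => let ⟨σ, _, hσ⟩ := hinv Λ; ⟨σ, hσ⟩⟩
  refine ⟨e.toContinuousLinearEquivOfBounds ‖B‖ K (fun σ => B.le_opNorm σ) fun Λ => ?_,
    fun σ f φ hf => hBφ σ f φ hf⟩
  obtain ⟨σ, hn, hσ⟩ := hinv Λ
  have : e.symm Λ = σ := by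
    rw [LinearEquiv.symm_apply_eq]
    exact hσ.symm
  rwa [this]

/-- A functional that vanishes on the Schwartz functions is zero, by the duality; the density
follows by the Hahn–Banach theorem. -/
theorem dense_schwartz [Countable ι] (hU : IsWeightedCovering U x) (hψ : IsBAPU U ψ)
    (hp : p ≠ ⊤) (hq : q ≠ ⊤) :
    Dense {f : DecompSpace x ψ s p q | ∃ φ : 𝓢(Euc d, ℂ),
      toDistribution x ψ s p q f = (φ : 𝓢'(Euc d, ℂ))} := by
  have hpp := ENNReal.HolderConjugate.inv_one_sub_inv' (Fact.out : 1 ≤ p)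
  have hqq := ENNReal.HolderConjugate.inv_one_sub_inv' (Fact.out : 1 ≤ q)
  have : Fact (1 ≤ (1 - p⁻¹)⁻¹) := ⟨hpp.symm.one_le⟩
  have : Fact (1 ≤ (1 - q⁻¹)⁻¹) := ⟨hqq.symm.one_le⟩
  obtain ⟨Φ, hΦ⟩ := exists_dual_equiv (p := p) (q := q) hU hψ s hpp hqq hp hq
  obtain ⟨J, hJ⟩ := exists_schwartz_embedding (s := s) (p := p) (q := q) hU hψ
  set M : Submodule ℂ (DecompSpace x ψ s p q) := LinearMap.range J.toLinearMap with hM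
  have hMeq : {f : DecompSpace x ψ s p q | ∃ φ : 𝓢(Euc d, ℂ),
      toDistribution x ψ s p q f = (φ : 𝓢'(Euc d, ℂ))} = M := by
    ext f
    constructor
    · rintro ⟨φ, hφ⟩
      exact ⟨φ, toDistribution_injective ((hJ φ).trans hφ.symm)⟩
    · rintro ⟨φ, rfl⟩
      exact ⟨φ, hJ φ⟩
  rw [hMeq]
  let _ : NormedSpace ℝ (DecompSpace x ψ s p q) := NormedSpace.restrictScalars ℝ ℂ _
  have : IsScalarTower ℝ ℂ (DecompSpace x ψ s p q) := RestrictScalars.isScalarTower _ _ _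
  intro f
  by_contra hf
  have hconv : Convex ℝ (closure (M : Set (DecompSpace x ψ s p q))) :=
    (M.restrictScalars ℝ).convex.closure
  obtain ⟨Λ, u, hlt, hu⟩ := RCLike.geometric_hahn_banach_closed_point (𝕜 := ℂ) hconv
    isClosed_closure hf
  -- a functional whose real part is bounded above on a subspace vanishes there
  have hΛ : ∀ m ∈ M, Λ m = 0 := fun m hm => by
    by_contra h0
    have h1 := hlt _ (subset_closure (M.smul_mem ((|u| : ℝ) / Λ m) hm))
    rw [map_smul, smul_eq_mul, div_mul_cancel₀ _ h0] at h1
    exact (le_abs_self u).not_gt (by simpa using h1)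
  have hσ : Φ.symm Λ = 0 := toDistribution_injective <| by
    ext φ
    rw [← hΦ _ (J φ) φ (hJ φ), Φ.apply_symm_apply, hΛ (J φ) ⟨φ, rfl⟩, map_zero]
    rfl
  have hΛ0 : Λ = 0 := by rw [← Φ.apply_symm_apply Λ, hσ, map_zero]
  have h2 := hlt 0 (subset_closure M.zero_mem)
  rw [hΛ0] at h2 hu
  simp only [_root_.zero_apply, map_zero] at h2 hu
  exact h2.not_gt hu

end DecompSpace

end Duality

end TimeDecomposition

theorem theorem2 {d : ℕ} {ι : Type*} [Countable ι]
    (T : ι → (TimeDecomposition.Euc d ≃ᵃ[ℝ] TimeDecomposition.Euc d))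
    (P Q : Set (TimeDecomposition.Euc d)) (x : ι → TimeDecomposition.Euc d)
    (hQ : TimeDecomposition.IsStructuredCovering T P Q x)
    (ψ : ι → TimeDecomposition.Euc d → ℝ)
    (hψ : TimeDecomposition.IsBAPU (TimeDecomposition.affineFamily T Q) ψ)
    (s : ℝ) (p q : ℝ≥0∞) [Fact (1 ≤ p)] [Fact (1 ≤ q)] :
    -- (1) the Schwartz space embeds continuously in `D`
    (∃ J : 𝓢(TimeDecomposition.Euc d, ℂ) →L[ℂ] TimeDecomposition.DecompSpace x ψ s p q,
      ∀ φ : 𝓢(TimeDecomposition.Euc d, ℂ),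
        TimeDecomposition.DecompSpace.toDistribution x ψ s p q (J φ) =
          (φ : 𝓢'(TimeDecomposition.Euc d, ℂ))) ∧
    -- (1) `D` embeds continuously in `𝓢'`, for the weak topology of `𝓢'` and, through a
    -- bound by one continuous seminorm of the test function, for the strong one as well
    Continuous (TimeDecomposition.DecompSpace.toDistribution x ψ s p q) ∧
    (∃ (C : ℝ) (N : ℕ), ∀ (f : TimeDecomposition.DecompSpace x ψ s p q)
      (φ : 𝓢(TimeDecomposition.Euc d, ℂ)),
        ‖TimeDecomposition.DecompSpace.toDistribution x ψ s p q f φ‖ ≤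
          C * ‖f‖ * (Finset.Iic (N, N)).sup
            (schwartzSeminormFamily ℂ (TimeDecomposition.Euc d) ℂ) φ) ∧
    -- (2) `D` is a Banach space
    ((∀ f : TimeDecomposition.DecompSpace x ψ s p q, ‖f‖ = 0 → f = 0) ∧
      CompleteSpace (TimeDecomposition.DecompSpace x ψ s p q)) ∧
    -- (3) density of the Schwartz space
    (p ≠ ⊤ → q ≠ ⊤ →
      Dense {f : TimeDecomposition.DecompSpace x ψ s p q |
        ∃ φ : 𝓢(TimeDecomposition.Euc d, ℂ),
          TimeDecomposition.DecompSpace.toDistribution x ψ s p q f =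
            (φ : 𝓢'(TimeDecomposition.Euc d, ℂ))}) ∧
    -- (4) the dual space, under the pairing that extends the one of `𝓢'` with `𝓢`
    (p ≠ ⊤ → q ≠ ⊤ →
      ∀ (p' q' : ℝ≥0∞) [Fact (1 ≤ p')] [Fact (1 ≤ q')],
        1 / p + 1 / p' = 1 → 1 / q + 1 / q' = 1 →
        ∃ Φ : TimeDecomposition.DecompSpace x ψ (-s) p' q' ≃L[ℂ]
            (TimeDecomposition.DecompSpace x ψ s p q →L[ℂ] ℂ),
          ∀ (σ : TimeDecomposition.DecompSpace x ψ (-s) p' q')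
            (f : TimeDecomposition.DecompSpace x ψ s p q)
            (φ : 𝓢(TimeDecomposition.Euc d, ℂ)),
            TimeDecomposition.DecompSpace.toDistribution x ψ s p q f =
                (φ : 𝓢'(TimeDecomposition.Euc d, ℂ)) →
              Φ σ f = TimeDecomposition.DecompSpace.toDistribution x ψ (-s) p' q' σ φ) := by
  have hU := hQ.isWeightedCovering
  refine ⟨TimeDecomposition.DecompSpace.exists_schwartz_embedding hU hψ,
    TimeDecomposition.DecompSpace.continuous_toDistribution hU hψ,
    TimeDecomposition.DecompSpace.exists_norm_apply_le hU hψ,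
    ⟨TimeDecomposition.DecompSpace.eq_zero_of_norm_eq_zero hU hψ,
      TimeDecomposition.DecompSpace.completeSpace hU hψ⟩,
    TimeDecomposition.DecompSpace.dense_schwartz hU hψ, ?_⟩
  intro hp hq p' q' _ _ hpp hqq
  refine TimeDecomposition.DecompSpace.exists_dual_equiv hU hψ s ?_ ?_ hp hq
  · exact ENNReal.holderConjugate_iff.2 (by simpa only [one_div] using hpp)
  · exact ENNReal.holderConjugate_iff.2 (by simpa only [one_div] using hqq)
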